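/- **Setting.** Let $V$ be a smooth manifold of even dimension $n+m$ with a local fibred structure, i.e. with a vertical distribution $vV\subset TV$ which is locally the kernel of the differential of a submersion onto an $n$-dimensional base. Let $N:TV\to vV$ be an N-connection (a smooth bundle morphism that is the identity on $vV$), so that $TV=hV\oplus vV$ with $hV=\ker N$, of ranks $n$ and $m$. Let $g$ be a smooth Riemannian metric for which $hV\perp vV$ (a d-metric), and let $hV$ and $vV$ be oriented. Let $\pi:B\to V$ be the bundle of N-adapted frames: the principal $SO(n)\times SO(m)$-bundle of pairs of positively oriented orthonormal frames of $hV$ and of $vV$. The *spin bundle gerbe* $\Psi\to B\times_V B$ is the lifting bundle gerbe of $Spin(n)\times Spin(m)\to SO(n)\times SO(m)$: its fibre over $(f_1,f_2)$ is the set of lifts to $Spin(n)\times Spin(m)$ of the element carrying $f_1$ to $f_2$, and the gerbe multiplication is group multiplication. An *N-anholonomic $\Psi^q$-module* is a pair $W=(W^h,W^v)$ of smooth Hermitian complex vector bundles over $B$ with a smooth unitary action of $\Psi$, by maps $W_{f_1}\to W_{f_2}$ for $\psi\in\Psi_{(f_1,f_2)}$, compatible with the gerbe multiplication (equivalently, a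 $Spin(n)\times Spin(m)$-equivariant structure), such that the subgroup $\{\pm1\}$ of $Spin(n)$ (resp. $Spin(m)$) acts with weight $q$, $\epsilon\mapsto\epsilon^q$, on $W^h$ (resp. $W^v$) and trivially on the other component. A *Clifford d-module* $E$ is a pair $(E^h,E^v)$ of smooth Hermitian complex vector bundles of finite rank over $V$, each $\mathbb Z_2$-graded with $E_+\perp E_-$, together with smooth odd Clifford multiplications of $hV$ on $E^h$ and of $vV$ on $E^v$ satisfying $c(X)^2=-g(X,X)$. The *d-spin representation* is $S=(S_n,S_m)$, where $S_k=S_k^+\oplus S_k^-$ is the irreducible $\mathbb Z_2$-graded complex module of the Clifford algebra $C(\mathbb R^k)$ with its Hermitian metric; for even $k$ it is the usual spin module of dimension $2^{k/2}$. **Theorem.** For every Clifford d-module $E$ on such a $V$ there are a $\mathbb Z_2$-graded N-anholonomic $\Psi^{-1}$-module $v^C$ and an isomorphism of smooth complex vector bundles over $B$, one for each of the two components, $$\Phi:\ S\otimes v^C\ \xrightarrow{\ \cong\ }\ E_B=\pi^{*}E ,$$ that preserves the $\mathbb Z_2$-gradings, is a morphism of Clifford modules (at $f\in B$, $\Phi(a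 s\otimes w)=c(f(a))\,\Phi(s\otimes w)$ for $a\in\mathbb R^n$, resp. $a\in\mathbb R^m$), and is equivariant for $\Psi$: for $\psi\in\Psi_{(f_1,f_2)}$, $\Phi_{f_2}(\psi^{-1}s\otimes \psi w)=\Phi_{f_1}(s\otimes w)$, where spin elements act on $S$ by the spin representation and $\Psi$ acts trivially on the fibres of $E_B$. On each component on which Clifford multiplication by vectors is skew-Hermitian, $\Phi$ is moreover unitary. -/

import Mathlib

universe u w w'

open scoped Manifold ContDiff TensorProduct Bundle
open Bundle Module
noncomputable section
namespace NGerbe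

/-! ### Clifford algebras, spin groups and spin modules -/

/-- The two components of a distinguished object: horizontal and vertical. -/
inductive Part
  | h
  | v

/-- The ranks of the horizontal and of the vertical distribution. -/
def Part.rank (n m : ℕ) : Part → ℕ
  | .h => n
  | .v => m

/-- The quadratic form `a ↦ -|a|²` on `ℝᵏ`; in its Clifford algebra `a² = -|a|²`. -/
def Q (k : ℕ) : QuadraticForm ℝ (Fin k → ℝ) :=
  QuadraticMap.weightedSumSquares ℝ (fun _ : Fin k => (-1 : ℝ))

/-- The Clifford algebra `C(ℝᵏ)`. -/
abbrev Cl (k : ℕ) : Type := CliffordAlgebra (Q k)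

/-- The group `Spin(k)`: even products of unit vectors in `C(ℝᵏ)`. -/
abbrev Spin (k : ℕ) : Type := spinGroup (Q k)

/-- A linear left inverse of the inclusion `ℝᵏ → C(ℝᵏ)`. -/
def vecPart (k : ℕ) : Cl k →ₗ[ℝ] (Fin k → ℝ) :=
  ExteriorAlgebra.ιInv ∘ₗ (CliffordAlgebra.equivExterior (Q k)).toLinearMap

theorem vecPart_ι (k : ℕ) (a : Fin k → ℝ) : vecPart k (CliffordAlgebra.ι (Q k) a) = a := by
  have h : CliffordAlgebra.equivExterior (Q k) (CliffordAlgebra.ι (Q k) a)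
      = ExteriorAlgebra.ι ℝ a := by
    simp [CliffordAlgebra.equivExterior, CliffordAlgebra.changeFormEquiv,
      CliffordAlgebra.changeForm_ι, ExteriorAlgebra.ι]
  simp only [vecPart, LinearMap.comp_apply, LinearEquiv.coe_coe, h]
  exact ExteriorAlgebra.ι_leftInverse a

/-- The covering homomorphism `Spin(k) → SO(k)`, `g ↦ (a ↦ g a g⁻¹)`. -/
def spinRot {k : ℕ} (g : Spin k) : (Fin k → ℝ) →ₗ[ℝ] (Fin k → ℝ) :=
  vecPart k ∘ₗ LinearMap.mulLeft ℝ (g : Cl k) ∘ₗ LinearMap.mulRight ℝ ((g⁻¹ : Spin k) : Cl k) ∘ₗ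
    CliffordAlgebra.ι (Q k)

theorem ι_spinRot {k : ℕ} (g : Spin k) (a : Fin k → ℝ) :
    CliffordAlgebra.ι (Q k) (spinRot g a) =
      (g : Cl k) * CliffordAlgebra.ι (Q k) a * ((g⁻¹ : Spin k) : Cl k) := by
  have h := spinGroup.conjAct_smul_ι_mem_range_ι (x := spinGroup.toUnits g) g.2 a
  rw [ConjAct.units_smul_def, ConjAct.ofConjAct_toConjAct] at h
  obtain ⟨b, hb⟩ := h
  have hb' : CliffordAlgebra.ι (Q k) b =
      (g : Cl k) * CliffordAlgebra.ι (Q k) a * ((g⁻¹ : Spin k) : Cl k) := hb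
  have : spinRot g a = b := by
    simp only [spinRot, LinearMap.comp_apply, LinearMap.mulLeft_apply, LinearMap.mulRight_apply,
      ← mul_assoc]
    rw [← hb', vecPart_ι]
  rw [this, hb']

theorem spinRot_mul {k : ℕ} (g g' : Spin k) (a : Fin k → ℝ) :
    spinRot (g * g') a = spinRot g (spinRot g' a) := by
  apply Function.LeftInverse.injective (vecPart_ι k)
  rw [ι_spinRot, ι_spinRot, ι_spinRot, mul_inv_rev]
  simp only [Submonoid.coe_mul, mul_assoc]

/-- The underlying Hermitian space of the spin module of `C(ℝᵏ)`: the exterior algebra of `ℂᴷ`,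
`K = ⌈k/2⌉`, in its standard orthonormal basis `e_T` indexed by the subsets `T` of
`{0, …, K - 1}`. For even `k` it is the irreducible complex module of `C(ℝᵏ)`, of dimension
`2^(k/2)`; for every `k` it is the irreducible `ℤ/2`-graded complex module. -/
abbrev SpinModule (k : ℕ) : Type := EuclideanSpace ℂ (Finset (Fin ((k + 1) / 2)))

/-- The sign `(-1)^#{i ∈ T, i < j}` of exterior and interior multiplication by `e_j`. -/
def extSign {K : ℕ} (j : Fin K) (T : Finset (Fin K)) : ℂ :=
  (-1) ^ (T.filter (fun i => i < j)).card

/-- `T` with the membership of `j` reversed. -/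
def flip {K : ℕ} (j : Fin K) (T : Finset (Fin K)) : Finset (Fin K) := symmDiff T {j}

/-- The matrix coefficients of `gammaOp`. -/
def gammaCoeff {k : ℕ} (p : Fin k) (T : Finset (Fin ((k + 1) / 2))) : ℂ :=
  let j : Fin ((k + 1) / 2) := ⟨(p : ℕ) / 2, by have := p.2; omega⟩
  if (p : ℕ) % 2 = 0 then (if j ∈ T then extSign j T else -extSign j T)
  else Complex.I * extSign j T

/-- The operator by which the `p`-th basis vector of `ℝᵏ` acts on the spin module:
`e_j ∧ - e_j ⌟` for `p = 2j` and `i (e_j ∧ + e_j ⌟)` for `p = 2j + 1`. -/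
def gammaOp {k : ℕ} (p : Fin k) : Module.End ℂ (SpinModule k) where
  toFun φ := WithLp.toLp 2 (fun T =>
    gammaCoeff p T * φ (flip ⟨(p : ℕ) / 2, by have := p.2; omega⟩ T))
  map_add' φ ψ := by ext T; simp; ring
  map_smul' z φ := by ext T; simp; ring

theorem mem_flip {K : ℕ} (j i : Fin K) (T : Finset (Fin K)) :
    i ∈ flip j T ↔ (if i = j then i ∉ T else i ∈ T) := by
  simp only [flip, Finset.mem_symmDiff, Finset.mem_singleton]
  split_ifs with h <;> simp [h]

theorem extSign_flip {K : ℕ} (j l : Fin K) (T : Finset (Fin K)) :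
    extSign j (flip l T) = if l < j then -extSign j T else extSign j T := by
  unfold extSign
  split_ifs with h
  · by_cases hl : l ∈ T
    · have : T.filter (fun i => i < j) = insert l ((flip l T).filter (fun i => i < j)) := by
        ext i; simp only [Finset.mem_insert, Finset.mem_filter, mem_flip]
        by_cases hi : i = l <;> simp_all
      rw [this, Finset.card_insert_of_notMem (by simp [mem_flip, hl]), pow_succ]; ring
    · have : (flip l T).filter (fun i => i < j) = insert l (T.filter (fun i => i < j)) := by
        ext i; simp only [Finset.mem_insert, Finset.mem_filter, mem_flip]
        by_cases hi : i = l <;> simp_all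
      rw [this, Finset.card_insert_of_notMem (by simp [hl]), pow_succ]; ring
  · congr 2
    ext i; simp only [Finset.mem_filter, mem_flip]
    by_cases hi : i = l <;> simp_all

theorem extSign_sq {K : ℕ} (j : Fin K) (T : Finset (Fin K)) : extSign j T * extSign j T = 1 := by
  unfold extSign; rw [← mul_pow]; norm_num

theorem gammaOp_anticomm {k : ℕ} (p q : Fin k) :
    gammaOp p * gammaOp q + gammaOp q * gammaOp p =
      (if p = q then (-2 : ℂ) else 0) • (1 : Module.End ℂ (SpinModule k)) := by
  ext φ T
  set jp : Fin ((k + 1) / 2) := ⟨(p : ℕ) / 2, by have := p.2; omega⟩ with hjp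
  set jq : Fin ((k + 1) / 2) := ⟨(q : ℕ) / 2, by have := q.2; omega⟩ with hjq
  have hcomm : flip jp (flip jq T) = flip jq (flip jp T) := by
    simp only [flip, symmDiff_assoc, symmDiff_comm {jq}]
  have key : gammaCoeff p T * gammaCoeff q (flip jp T) +
      gammaCoeff q T * gammaCoeff p (flip jq T) = 0 ∨ p = q := by
    by_cases hpq : p = q
    · exact Or.inr hpq
    left
    have e1 := extSign_sq jp T
    have e2 := extSign_sq jq T
    unfold gammaCoeff
    simp only [← hjp, ← hjq, extSign_flip, mem_flip]
    rcases lt_trichotomy jp jq with h | h | h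
    · have h1 := h.ne
      have h2 := h.ne'
      have h3 := h.not_gt
      simp only [h, h1, h2, h3, if_true, if_false]
      split_ifs <;> ring
    · have hv : (p : ℕ) / 2 = (q : ℕ) / 2 := by
        have := congrArg Fin.val h; simpa [hjp, hjq] using this
      have hne : (p : ℕ) ≠ q := fun h => hpq (Fin.ext h)
      rw [← h]
      simp only [lt_irrefl, if_true, if_false]
      split_ifs <;> first | (exfalso; omega) | ring
    · have h1 := h.ne
      have h2 := h.ne'
      have h3 := h.not_gt
      simp only [h, h1, h2, h3, if_true, if_false]
      split_ifs <;> ring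
  have hL : ((gammaOp p * gammaOp q + gammaOp q * gammaOp p) φ) T =
      gammaCoeff p T * (gammaCoeff q (flip jp T) * φ (flip jq (flip jp T))) +
      gammaCoeff q T * (gammaCoeff p (flip jq T) * φ (flip jp (flip jq T))) := rfl
  rw [hL, hcomm]
  by_cases hpq : p = q
  · subst hpq
    have e1 := extSign_sq jp T
    have hflip : flip jp (flip jp T) = T := by simp [flip]
    have hc : gammaCoeff p T * gammaCoeff p (flip jp T) = -1 := by
      unfold gammaCoeff
      simp only [← hjp, extSign_flip, mem_flip, lt_irrefl, if_true, if_false]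
      split_ifs
      · linear_combination (-1 : ℂ) * e1
      · linear_combination (-1 : ℂ) * e1
      · linear_combination (extSign jp T) ^ 2 * Complex.I_mul_I - e1
    rw [hflip]
    simp only [if_true, LinearMap.smul_apply, Module.End.one_apply, PiLp.smul_apply, smul_eq_mul]
    linear_combination 2 * φ T * hc
  · rcases key with key | key
    · simp only [hpq, if_false, zero_smul, LinearMap.zero_apply, PiLp.zero_apply]
      linear_combination φ (flip jq (flip jp T)) * key
    · exact absurd key hpq

/-- Clifford multiplication by vectors of `ℝᵏ` on the spin module. -/
def gammaVec (k : ℕ) : (Fin k → ℝ) →ₗ[ℝ] Module.End ℂ (SpinModule k) :=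
  Fintype.linearCombination ℝ (fun p : Fin k => gammaOp p)

theorem gammaVec_sq (k : ℕ) (a : Fin k → ℝ) :
    gammaVec k a * gammaVec k a = algebraMap ℝ (Module.End ℂ (SpinModule k)) (Q k a) := by
  have h2 : gammaVec k a * gammaVec k a + gammaVec k a * gammaVec k a =
      (2 : ℝ) • algebraMap ℝ (Module.End ℂ (SpinModule k)) (Q k a) := by
    have e1 : gammaVec k a * gammaVec k a =
        ∑ p, ∑ q, (a p * a q) • (gammaOp p * gammaOp q) := by
      simp only [gammaVec, Fintype.linearCombination_apply, Finset.sum_mul_sum, smul_mul_smul_comm]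
    have e2 : gammaVec k a * gammaVec k a =
        ∑ p, ∑ q, (a p * a q) • (gammaOp q * gammaOp p) := by
      rw [e1, Finset.sum_comm]
      simp only [mul_comm]
    nth_rewrite 1 [e1]
    rw [e2]
    simp only [← Finset.sum_add_distrib, ← smul_add, gammaOp_anticomm]
    simp only [ite_smul, zero_smul, smul_ite, smul_zero, Finset.sum_ite_eq, Finset.mem_univ,
      if_true, Q, QuadraticMap.weightedSumSquares_apply, Algebra.algebraMap_eq_smul_one,
      Finset.sum_smul, Finset.smul_sum]
    refine Finset.sum_congr rfl fun p _ => ?_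
    ext φ T
    simp
    ring
  have h3 := two_smul ℝ (gammaVec k a * gammaVec k a)
  rw [← h3] at h2
  exact smul_right_injective _ (two_ne_zero (α := ℝ)) h2

/-- The spin representation of the Clifford algebra `C(ℝᵏ)`, and in particular of `Spin(k)`. -/
def spinRep (k : ℕ) : Cl k →ₐ[ℝ] Module.End ℂ (SpinModule k) :=
  CliffordAlgebra.lift (Q k) ⟨gammaVec k, gammaVec_sq k⟩

/-- The grading operator of `S = S⁺ ⊕ S⁻`: it is `(-1)^#T` on `e_T`. -/
def spinGrading (k : ℕ) : Module.End ℂ (SpinModule k) where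
  toFun φ := WithLp.toLp 2 (fun T => (-1 : ℂ) ^ T.card * φ T)
  map_add' φ ψ := by ext T; simp; ring
  map_smul' z φ := by ext T; simp; ring

/-! ### N-anholonomic manifolds and their bundles of N-adapted frames -/

/-- A nonlinear connection on a smooth manifold `V` of dimension `n + m` with a local fibred
structure: a vertical bundle `vV = vert`, which locally is the kernel of the differential of a
submersion onto an `n`-dimensional base, and a morphism `N : TV → vV` that is the identity
on `vV`. -/
structure NConnection (n m : ℕ) (V : Type u) [TopologicalSpace V]
    [ChartedSpace (EuclideanSpace ℝ (Fin (n + m))) V] [IsManifold (𝓡 (n + m)) ∞ V] where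
  vert : ∀ x : V, Submodule ℝ (TangentSpace (𝓡 (n + m)) x)
  fibred : ∀ x : V, ∃ U : Set V, IsOpen U ∧ x ∈ U ∧ ∃ pr : V → EuclideanSpace ℝ (Fin n),
    ContMDiffOn (𝓡 (n + m)) (𝓡 n) ∞ pr U ∧
    ∀ y ∈ U, Function.Surjective (mfderiv (𝓡 (n + m)) (𝓡 n) pr y) ∧
      ∀ X : TangentSpace (𝓡 (n + m)) y, X ∈ vert y ↔ mfderiv (𝓡 (n + m)) (𝓡 n) pr y X = 0
  N : ∀ x : V, TangentSpace (𝓡 (n + m)) x →ₗ[ℝ] TangentSpace (𝓡 (n + m)) x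
  N_mem : ∀ x X, N x X ∈ vert x
  N_eq : ∀ x, ∀ X ∈ vert x, N x X = X
  N_smooth : ContMDiff (𝓡 (n + m)).tangent (𝓡 (n + m)).tangent ∞
    (fun p : TangentBundle (𝓡 (n + m)) V => (⟨p.1, N p.1 p.2⟩ : TangentBundle (𝓡 (n + m)) V))

section

variable {n m : ℕ} {V : Type u} [TopologicalSpace V]
  [ChartedSpace (EuclideanSpace ℝ (Fin (n + m))) V] [IsManifold (𝓡 (n + m)) ∞ V]

/-- The summands of the Whitney sum `TV = hV ⊕ vV`, with `hV = ker N`. -/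
def NConnection.dist (N : NConnection n m V) (c : Part) (x : V) :
    Submodule ℝ (TangentSpace (𝓡 (n + m)) x) :=
  match c with
  | .h => LinearMap.ker (N.N x)
  | .v => N.vert x

/-- The vector field `X` is smooth on `U`. -/
def SmoothField (X : ∀ x : V, TangentSpace (𝓡 (n + m)) x) (U : Set V) : Prop :=
  ContMDiffOn (𝓡 (n + m)) (𝓡 (n + m)).tangent ∞
    (fun x => (⟨x, X x⟩ : TangentBundle (𝓡 (n + m)) V)) U

variable (n m V) in
/-- An oriented N-anholonomic manifold with d-metric: a nonlinear connection, a Riemannian metric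
for which `hV` and `vV` are orthogonal, and smooth orientations of `hV` and of `vV` (around each
point there are smooth positively oriented frames). -/
structure NAnholonomic extends NConnection n m V where
  g : ContMDiffRiemannianMetric (𝓡 (n + m)) ∞ (EuclideanSpace ℝ (Fin (n + m)))
    (fun x : V => TangentSpace (𝓡 (n + m)) x)
  g_adapted : ∀ x, ∀ X ∈ toNConnection.dist .h x, ∀ Y ∈ toNConnection.dist .v x,
    g.inner x X Y = 0
  orient : ∀ (c : Part) (x : V),
    Orientation ℝ (toNConnection.dist c x) (Fin (c.rank n m))
  orient_smooth : ∀ (c : Part) (x : V), ∃ U : Set V, IsOpen U ∧ x ∈ U ∧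
    ∃ X : Fin (c.rank n m) → ∀ y : V, TangentSpace (𝓡 (n + m)) y,
      (∀ i, SmoothField (X i) U) ∧
      ∀ y ∈ U, ∃ b : Basis (Fin (c.rank n m)) ℝ (toNConnection.dist c y),
        (∀ i, (b i : TangentSpace (𝓡 (n + m)) y) = X i y) ∧ b.orientation = orient c y

namespace NAnholonomic

/-- An N-adapted frame at `x`: positively oriented orthonormal bases of `hV` and of `vV`. -/
structure Frame (M : NAnholonomic n m V) (x : V) where
  basis : ∀ c : Part, Basis (Fin (c.rank n m)) ℝ (M.dist c x)
  orthonormal : ∀ c i j, M.g.inner x (basis c i) (basis c j) = if i = j then 1 else 0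
  oriented : ∀ c, (basis c).orientation = M.orient c x

/-- The vector of `hV` or `vV` with components `a ∈ ℝᵏ` in the frame `f`. -/
def Frame.vec {M : NAnholonomic n m V} {x : V} (f : M.Frame x) (c : Part)
    (a : Fin (c.rank n m) → ℝ) : M.dist c x :=
  ∑ i, a i • f.basis c i

/-- The total space of the bundle `B` of N-adapted frames. -/
abbrev FrameBundle (M : NAnholonomic n m V) : Type u := Σ x : V, M.Frame x

/-- The `i`-th frame vector of component `c`, as a point of `TV`. -/
def FrameBundle.leg {M : NAnholonomic n m V} (c : Part) (i : Fin (c.rank n m))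
    (b : M.FrameBundle) : TangentBundle (𝓡 (n + m)) V :=
  ⟨b.1, (b.2.basis c i : TangentSpace (𝓡 (n + m)) b.1)⟩

/-- The topology of `B` as a subspace of the Whitney sum of `n + m` copies of `TV`. -/
instance (M : NAnholonomic n m V) : TopologicalSpace M.FrameBundle :=
  TopologicalSpace.induced Sigma.fst inferInstance ⊓
    ⨅ (c : Part) (i : Fin (c.rank n m)),
      TopologicalSpace.induced (FrameBundle.leg (M := M) c i) inferInstance

/-- A map from an open subset `U` of `ℝᵈ` to `B` is smooth if it is smooth as a map to the Whitney
sum of `n + m` copies of `TV`, of which `B` is a submanifold. -/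
def SmoothPlot (M : NAnholonomic n m V) {d : ℕ} (U : Set (EuclideanSpace ℝ (Fin d)))
    (p : EuclideanSpace ℝ (Fin d) → M.FrameBundle) : Prop :=
  ContMDiffOn (𝓡 d) (𝓡 (n + m)) ∞ (fun t => (p t).1) U ∧
  ∀ c i, ContMDiffOn (𝓡 d) (𝓡 (n + m)).tangent ∞ (fun t => FrameBundle.leg c i (p t)) U

/-- A function on the manifold `B` is smooth on the open set `O` if it is smooth along every smooth
map from an open subset of some `ℝᵈ` to `O` (such as the inverse of a chart). -/
def SmoothFun (M : NAnholonomic n m V) (f : M.FrameBundle → ℂ) (O : Set M.FrameBundle) : Prop :=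
  ∀ (d : ℕ) (U : Set (EuclideanSpace ℝ (Fin d))) (p : EuclideanSpace ℝ (Fin d) → M.FrameBundle),
    IsOpen U → M.SmoothPlot U p → (∀ t ∈ U, p t ∈ O) → ContDiffOn ℝ ∞ (fun t => f (p t)) U

/-! ### The spin bundle gerbe and its modules -/

/-- The fibre `Ψ_(f₁, f₂)` of the spin bundle gerbe over a pair of frames at the same point: the
lifts to the spin d-group `Spin(n) × Spin(m)` of the element `τ(f₁, f₂)` of `SO(n) × SO(m)` that
carries `f₁` to `f₂`, where `A` acts on frames from the right by `(f A)(a) = f (A a)`. -/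
def Psi {M : NAnholonomic n m V} {x : V} (f₁ f₂ : M.Frame x) : Type :=
  {s : ∀ c : Part, Spin (c.rank n m) // ∀ c a, f₂.vec c a = f₁.vec c (spinRot (s c) a)}

/-- The bundle gerbe multiplication `Ψ_(f₁, f₂) × Ψ_(f₂, f₃) → Ψ_(f₁, f₃)`. -/
def Psi.comp {M : NAnholonomic n m V} {x : V} {f₁ f₂ f₃ : M.Frame x}
    (ψ : Psi f₁ f₂) (χ : Psi f₂ f₃) : Psi f₁ f₃ :=
  ⟨fun c => ψ.1 c * χ.1 c, fun c a => by rw [χ.2, ψ.2, spinRot_mul]⟩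

/-- The total space of `Ψ → B ×_V B`. -/
structure PsiTotal (M : NAnholonomic n m V) where
  pt : V
  src : M.Frame pt
  tgt : M.Frame pt
  lift : Psi src tgt

/-- Smooth maps from an open subset of `ℝᵈ` to `Ψ`, a submanifold of
`B × B × Spin(n) × Spin(m)`. -/
def SmoothPsiPlot (M : NAnholonomic n m V) {d : ℕ} (U : Set (EuclideanSpace ℝ (Fin d)))
    (p : EuclideanSpace ℝ (Fin d) → M.PsiTotal) : Prop :=
  M.SmoothPlot U (fun t => ⟨(p t).pt, (p t).src⟩) ∧
  M.SmoothPlot U (fun t => ⟨(p t).pt, (p t).tgt⟩) ∧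
  ∀ (c : Part) (ℓ : Cl (c.rank n m) →ₗ[ℝ] ℝ),
    ContDiffOn ℝ ∞ (fun t => ℓ ((p t).lift.1 c : Cl (c.rank n m))) U

/-- A local frame, over an open set `dom`, of a family of vector spaces over `B`. -/
structure LocalFrame (M : NAnholonomic n m V) (W : M.FrameBundle → Type w)
    [∀ b, AddCommGroup (W b)] [∀ b, Module ℂ (W b)] where
  dom : Set M.FrameBundle
  isOpen : IsOpen dom
  rk : ℕ
  vec : Fin rk → ∀ b, W b
  linearIndependent : ∀ b ∈ dom, LinearIndependent ℂ (fun i => vec i b)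
  span : ∀ b ∈ dom, Submodule.span ℂ (Set.range (fun i => vec i b)) = ⊤

/-- A smooth Hermitian complex vector bundle over `B`, given by its fibres and by an atlas of local
frames with smooth Hermitian products (hence with smooth metric and smooth transition matrices). -/
structure HermitianBundle (M : NAnholonomic n m V) where
  fiber : M.FrameBundle → Type w
  [normed : ∀ b, NormedAddCommGroup (fiber b)]
  [innerProd : ∀ b, InnerProductSpace ℂ (fiber b)]
  atlas : Set (M.LocalFrame fiber)
  cover : ∀ b, ∃ e ∈ atlas, b ∈ e.dom
  smooth : ∀ e ∈ atlas, ∀ e' ∈ atlas, ∀ i j,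
    M.SmoothFun (fun b => Inner.inner ℂ (e.vec i b) (e'.vec j b)) (e.dom ∩ e'.dom)

attribute [instance] HermitianBundle.normed HermitianBundle.innerProd

/-- An N-anholonomic `Ψ^q`-module: a horizontal and a vertical smooth Hermitian vector bundle over
`B`, on which `Ψ` acts smoothly, unitarily and compatibly with the gerbe multiplication (that is,
the spin d-group acts, covering its action on `B` through `SO(n) × SO(m)`), such that on each
component the corresponding factor `ℤ/2 = {±1}` of the isotropy group of a frame acts with
weight `q`, and the other factor trivially. -/
structure PsiModule (M : NAnholonomic n m V) (q : ℤ) where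
  bundle : Part → HermitianBundle.{u, w} M
  act : ∀ (c : Part) {x : V} {f₁ f₂ : M.Frame x}, Psi f₁ f₂ →
    (bundle c).fiber ⟨x, f₁⟩ ≃ₗᵢ[ℂ] (bundle c).fiber ⟨x, f₂⟩
  act_comp : ∀ (c : Part) {x : V} {f₁ f₂ f₃ : M.Frame x} (ψ : Psi f₁ f₂) (χ : Psi f₂ f₃)
    (ξ : (bundle c).fiber ⟨x, f₁⟩), act c (ψ.comp χ) ξ = act c χ (act c ψ ξ)
  act_weight : ∀ (c : Part) {x : V} {f : M.Frame x} (ζ : Psi f f) (ε : ℤˣ),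
    (ζ.1 c : Cl (c.rank n m)) = algebraMap ℝ _ ((ε : ℤ) : ℝ) →
      ∀ ξ : (bundle c).fiber ⟨x, f⟩, act c ζ ξ = (((ε : ℤ) : ℂ) ^ q) • ξ
  act_smooth : ∀ (c : Part), ∀ e ∈ (bundle c).atlas, ∀ e' ∈ (bundle c).atlas, ∀ i j,
    ∀ (d : ℕ) (U : Set (EuclideanSpace ℝ (Fin d))) (p : EuclideanSpace ℝ (Fin d) → M.PsiTotal),
      IsOpen U → M.SmoothPsiPlot U p →
      (∀ t ∈ U, ⟨(p t).pt, (p t).src⟩ ∈ e.dom ∧ ⟨(p t).pt, (p t).tgt⟩ ∈ e'.dom) →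
      ContDiffOn ℝ ∞ (fun t => Inner.inner ℂ (e'.vec j ⟨(p t).pt, (p t).tgt⟩)
        (act c (p t).lift (e.vec i ⟨(p t).pt, (p t).src⟩))) U

/-- The fibre of a component of a `Ψ^q`-module at a frame. -/
abbrev PsiModule.fiber {M : NAnholonomic n m V} {q : ℤ} (W : PsiModule.{u, w} M q) (c : Part)
    {x : V} (f : M.Frame x) : Type w :=
  (W.bundle c).fiber ⟨x, f⟩

/-- A `ℤ/2`-grading of a `Ψ^q`-module, given by the grading operator: a smooth self-adjoint
involution that commutes with the action of `Ψ`. -/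
structure PsiModule.Grading {M : NAnholonomic n m V} {q : ℤ} (W : PsiModule.{u, w} M q) where
  op : ∀ (c : Part) {x : V} (f : M.Frame x), W.fiber c f →ₗ[ℂ] W.fiber c f
  op_op : ∀ c {x} (f : M.Frame x) ξ, op c f (op c f ξ) = ξ
  symm : ∀ c {x} (f : M.Frame x) ξ η,
    Inner.inner ℂ (op c f ξ) η = Inner.inner ℂ ξ (op c f η)
  act : ∀ c {x} {f₁ f₂ : M.Frame x} (ψ : Psi f₁ f₂) (ξ : W.fiber c f₁),
    op c f₂ (W.act c ψ ξ) = W.act c ψ (op c f₁ ξ)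
  smooth : ∀ c, ∀ e ∈ (W.bundle c).atlas, ∀ i j,
    M.SmoothFun (fun b => Inner.inner ℂ (e.vec i b) (op c b.2 (e.vec j b))) e.dom

end NAnholonomic

/-! ### Clifford d-modules -/

/-- A Clifford d-module structure on the Hermitian d-vector bundle `E = hE ⊕ vE` over `V`: smooth
Clifford multiplications of `hV` on `hE` and of `vV` on `vE`, with `X · X = -|X|²`, that are odd for
smooth `ℤ/2`-gradings `E = E₊ ⊕ E₋` (given by grading operators) with `E₊` orthogonal to `E₋`. -/
structure CliffordDModule (M : NAnholonomic n m V)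
    (F : Part → Type w') [∀ c, NormedAddCommGroup (F c)] [∀ c, NormedSpace ℂ (F c)]
    (E : Part → V → Type w) [∀ c x, NormedAddCommGroup (E c x)]
    [∀ c x, InnerProductSpace ℂ (E c x)] [∀ c, TopologicalSpace (TotalSpace (F c) (E c))]
    [∀ c, FiberBundle (F c) (E c)] [∀ c, VectorBundle ℝ (F c) (E c)] where
  cliff : ∀ (c : Part) (x : V), M.dist c x →ₗ[ℝ] Module.End ℂ (E c x)
  cliff_cliff : ∀ c x X ξ, cliff c x X (cliff c x X ξ) = -((M.g.inner x X X : ℝ) : ℂ) • ξ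
  grading : ∀ (c : Part) (x : V), Module.End ℂ (E c x)
  grading_grading : ∀ c x ξ, grading c x (grading c x ξ) = ξ
  grading_symm : ∀ c x ξ η,
    Inner.inner ℂ (grading c x ξ) η = Inner.inner ℂ ξ (grading c x η)
  cliff_odd : ∀ c x X ξ, grading c x (cliff c x X ξ) = -cliff c x X (grading c x ξ)
  inner_smooth : ∀ (c : Part) (U : Set V) (σ σ' : ∀ x, E c x), IsOpen U →
    ContMDiffOn (𝓡 (n + m)) ((𝓡 (n + m)).prod 𝓘(ℝ, F c)) ∞ (fun x => TotalSpace.mk' (F c) x (σ x)) U →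
    ContMDiffOn (𝓡 (n + m)) ((𝓡 (n + m)).prod 𝓘(ℝ, F c)) ∞ (fun x => TotalSpace.mk' (F c) x (σ' x)) U →
    ContMDiffOn (𝓡 (n + m)) 𝓘(ℝ, ℂ) ∞ (fun x => Inner.inner ℂ (σ x) (σ' x)) U
  cliff_smooth : ∀ (c : Part) (U : Set V) (X : ∀ x, M.dist c x) (σ : ∀ x, E c x), IsOpen U →
    SmoothField (fun x => (X x : TangentSpace (𝓡 (n + m)) x)) U →
    ContMDiffOn (𝓡 (n + m)) ((𝓡 (n + m)).prod 𝓘(ℝ, F c)) ∞ (fun x => TotalSpace.mk' (F c) x (σ x)) U →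
    ContMDiffOn (𝓡 (n + m)) ((𝓡 (n + m)).prod 𝓘(ℝ, F c)) ∞
      (fun x => TotalSpace.mk' (F c) x (cliff c x (X x) (σ x))) U
  grading_smooth : ∀ (c : Part) (U : Set V) (σ : ∀ x, E c x), IsOpen U →
    ContMDiffOn (𝓡 (n + m)) ((𝓡 (n + m)).prod 𝓘(ℝ, F c)) ∞ (fun x => TotalSpace.mk' (F c) x (σ x)) U →
    ContMDiffOn (𝓡 (n + m)) ((𝓡 (n + m)).prod 𝓘(ℝ, F c)) ∞
      (fun x => TotalSpace.mk' (F c) x (grading c x (σ x))) U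

end

end NGerbe

end

/-! In a frame `f`, each component of `E` becomes a graded module over `C(ℝᵏ)`, with `k` the rank of
that component. The twisting bundle is the multiplicity space `Hom(S, E)` of morphisms from the spin
module, and `Φ` is evaluation `s ⊗ w ↦ w s`, up to a constant. The claims reduce to fibrewise
algebra together with smooth dependence on the frame.

Algebra. Clifford multiplication generates all of `End(S)` when `k` is even. The parity of `n + m`
does not make `n` and `m` even separately. For odd `k` the grading operator is needed as one more
generator, so morphisms are then required to be even as well (`gen`). With this choice every matrix
unit lies in the generated algebra (`matUnit_mem_spinAlgebra`). This gives injectivity of evaluation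
(`eval_injective`). Surjectivity holds because `E` is spanned by joint eigenvectors of the commuting
involutions `sigma`. Each such vector has the eigenvalues of some basis vector `e_T`, and averaging
the map `e_T ↦ ξ` over conjugation by generators gives a morphism that hits a nonzero multiple of
`ξ` (`mem_range_eval_of_eigenvector`).

Metric. The multiplicity space carries the Hilbert-Schmidt product `∑ ⟪v e_T, w e_T⟫`. If vectors
act by skew-Hermitian operators, the matrix units show that `⟪v s, w t⟫` is `⟪s, t⟫` times a number
independent of `s` and `t` (`inner_hom`). Summing over the `2 ^ ((k + 1) / 2)` basis vectors
identifies that number and explains the factor `evalScale`.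

Gerbe action. A lift `g` carrying `f₁` to `f₂` acts by `w ↦ w ∘ g`. This sends morphisms for `f₁` to
morphisms for `f₂` (`comp_spinRep_mem`), is isometric because `Spin(k)` acts unitarily on `S`, and
cancels against `g⁻¹` on `S`, which is the equivariance of `Φ`. The element `-1` acts by `-1`,
whence the weight. The grading is `w ↦ Γ ∘ w ∘ Γ_S`.

Smoothness. The projection `proj` of all linear maps onto the morphisms is a polynomial in the
generators, so it varies smoothly with the frame. Extending a basis of one multiplicity space
constantly in a trivialization of `E` and projecting gives smooth local frames
(`exists_smoothFrame`). -/

noncomputable section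

namespace NGerbe

/-! ### Averaging over commuting involutions -/

section Averaging

variable {ι H : Type*} [AddCommGroup H] [Module ℂ H]

/-- The product of the averages `(1 + R i) / 2` over a list of indices. -/
def averageList (R : ι → Module.End ℂ H) (l : List ι) : Module.End ℂ H :=
  (l.map fun i => (1 / 2 : ℂ) • (1 + R i)).prod

variable (R : ι → Module.End ℂ H)

theorem averageList_cons (i : ι) (l : List ι) (w : H) :
    averageList R (i :: l) w = (1 / 2 : ℂ) • (averageList R l w + R i (averageList R l w)) := by
  simp [averageList]

theorem averageList_nil (w : H) : averageList R [] w = w := by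
  simp [averageList]

theorem averageList_of_fixed {l : List ι} {w : H} (hw : ∀ i ∈ l, R i w = w) :
    averageList R l w = w := by
  induction l with
  | nil => simp [averageList]
  | cons i l ih =>
    rw [averageList_cons, ih fun j hj => hw j (List.mem_cons_of_mem _ hj),
      hw i List.mem_cons_self, ← two_smul ℂ w, smul_smul]
    norm_num

variable {R}

theorem averageList_comm (hR : ∀ i j w, R i (R j w) = R j (R i w)) (i : ι) (l : List ι) (w : H) :
    R i (averageList R l w) = averageList R l (R i w) := by
  induction l with
  | nil => simp [averageList]
  | cons j l ih => rw [averageList_cons, averageList_cons, map_smul, map_add, hR i j, ih]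

/-- By commutativity `R i` can be moved to its own factor, which absorbs it: `R (1 + R) = 1 + R`
when `R² = 1`. -/
theorem averageList_fixed (hR : ∀ i j w, R i (R j w) = R j (R i w))
    (hR2 : ∀ i w, R i (R i w) = w) {i : ι} {l : List ι} (hi : i ∈ l) (w : H) :
    R i (averageList R l w) = averageList R l w := by
  induction l with
  | nil => simp at hi
  | cons j l ih =>
    rw [averageList_cons, map_smul, map_add]
    rcases List.mem_cons.1 hi with rfl | hi
    · rw [hR2, add_comm]
    · rw [hR i j, ih hi]

/-- Commuting involutions are simultaneously diagonalizable. -/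
theorem span_joint_eigenvectors (hR : ∀ i j w, R i (R j w) = R j (R i w))
    (hR2 : ∀ i w, R i (R i w) = w) (l : List ι) :
    Submodule.span ℂ {η : H | ∀ i ∈ l, R i η = η ∨ R i η = -η} = ⊤ := by
  induction l with
  | nil => simp
  | cons i l ih =>
    rw [eq_top_iff, ← ih, Submodule.span_le]
    intro η hη
    -- The two halves are eigenvectors of `R i`, and they remain eigenvectors of the other
    -- involutions because those commute with `R i`.
    have h1 : η = (1 / 2 : ℂ) • (η + R i η) + (1 / 2 : ℂ) • (η - R i η) := by
      rw [← smul_add, add_add_sub_cancel, ← two_smul ℂ η, smul_smul]; norm_num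
    rw [h1]
    refine Submodule.add_mem _ (Submodule.smul_mem _ _ (Submodule.subset_span ?_))
      (Submodule.smul_mem _ _ (Submodule.subset_span ?_))
    · intro j hj
      rcases List.mem_cons.1 hj with rfl | hj
      · left; rw [map_add, hR2, add_comm]
      · rw [map_add, hR j i]
        rcases hη j hj with h | h <;> rw [h]
        · left; rfl
        · right; rw [map_neg]; abel
    · intro j hj
      rcases List.mem_cons.1 hj with rfl | hj
      · right; rw [map_sub, hR2, neg_sub]
      · rw [map_sub, hR j i]
        rcases hη j hj with h | h <;> rw [h]
        · left; rfl
        · right; rw [map_neg]; abel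

end Averaging

/-! ### Graded Clifford modules in terms of generators -/

/-- A graded complex module of the Clifford algebra `C(ℝᵏ)`: the action of the standard basis of
`ℝᵏ` and the grading operator. -/
structure CliffordSystem (k : ℕ) (X : Type*) [AddCommGroup X] [Module ℂ X] where
  c : Fin k → Module.End ℂ X
  Γ : Module.End ℂ X
  anticomm : ∀ p q, c p * c q + c q * c p = (if p = q then (-2 : ℂ) else 0) • (1 : Module.End ℂ X)
  Γ_sq : Γ * Γ = 1
  Γ_c : ∀ p, Γ * c p = -(c p * Γ)

theorem spinGrading_apply {k : ℕ} (φ : SpinModule k) (T) :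
    spinGrading k φ T = (-1) ^ T.card * φ T := rfl

theorem gammaOp_apply {k : ℕ} (p : Fin k) (φ : SpinModule k) (T) :
    gammaOp p φ T = gammaCoeff p T * φ (flip ⟨(p : ℕ) / 2, by have := p.2; omega⟩ T) := rfl

theorem flip_flip {K : ℕ} (j : Fin K) (T : Finset (Fin K)) : flip j (flip j T) = T := by
  simp [flip]

theorem neg_one_pow_card_flip {K : ℕ} (j : Fin K) (T : Finset (Fin K)) :
    (-1 : ℂ) ^ (flip j T).card = -(-1) ^ T.card := by
  by_cases h : j ∈ T
  · have : T = insert j (flip j T) := by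
      ext i; simp only [Finset.mem_insert, mem_flip]
      by_cases hi : i = j <;> simp_all
    nth_rewrite 2 [this]
    rw [Finset.card_insert_of_notMem (by simp [mem_flip, h]), pow_succ]; ring
  · have : flip j T = insert j T := by
      ext i; simp only [Finset.mem_insert, mem_flip]
      by_cases hi : i = j <;> simp_all
    rw [this, Finset.card_insert_of_notMem h, pow_succ]; ring

/-- The spin module as a Clifford system. -/
def spinSystem (k : ℕ) : CliffordSystem k (SpinModule k) where
  c := gammaOp
  Γ := spinGrading k
  anticomm := gammaOp_anticomm
  Γ_sq := by
    ext φ T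
    simp only [Module.End.mul_apply, spinGrading_apply, Module.End.one_apply]
    rw [← mul_assoc, ← mul_pow]; norm_num
  Γ_c p := by
    ext φ T
    simp only [Module.End.mul_apply, spinGrading_apply, LinearMap.neg_apply, PiLp.neg_apply,
      gammaOp_apply, neg_one_pow_card_flip]
    ring

namespace CliffordSystem

variable {k : ℕ} {X : Type*} [AddCommGroup X] [Module ℂ X] (A : CliffordSystem k X)

theorem c_c (p : Fin k) (ξ : X) : A.c p (A.c p ξ) = -ξ := by
  have h := LinearMap.congr_fun (A.anticomm p p) ξ
  simp only [if_true, LinearMap.add_apply, Module.End.mul_apply, LinearMap.smul_apply,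
    Module.End.one_apply, ← two_smul ℂ (A.c p (A.c p ξ))] at h
  rw [neg_smul, ← smul_neg] at h
  exact smul_right_injective _ (two_ne_zero (α := ℂ)) h

theorem c_comm {p q : Fin k} (h : p ≠ q) (ξ : X) : A.c p (A.c q ξ) = -A.c q (A.c p ξ) := by
  have := LinearMap.congr_fun (A.anticomm p q) ξ
  simp only [h, if_false, LinearMap.add_apply, Module.End.mul_apply, zero_smul,
    LinearMap.zero_apply] at this
  exact eq_neg_of_add_eq_zero_left this

theorem Γ_Γ (ξ : X) : A.Γ (A.Γ ξ) = ξ := LinearMap.congr_fun A.Γ_sq ξ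

theorem Γ_c_apply (p : Fin k) (ξ : X) : A.Γ (A.c p ξ) = -A.c p (A.Γ ξ) :=
  LinearMap.congr_fun (A.Γ_c p) ξ

/-- The operators that a morphism from the irreducible graded module has to intertwine: Clifford
multiplication, and for odd `k` also the grading. -/
def gen : Option (Fin k) → Module.End ℂ X
  | none => if Odd k then A.Γ else 1
  | some p => A.c p

theorem gen_some (p : Fin k) : A.gen (some p) = A.c p := rfl

variable (k) in
/-- The sign `s` with `gen i * gen i = s`. -/
def genSign : Option (Fin k) → ℂ
  | none => 1
  | some _ => -1

theorem genSign_sq (i : Option (Fin k)) : genSign k i * genSign k i = 1 := by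
  cases i <;> simp [genSign]

theorem gen_gen (i : Option (Fin k)) (ξ : X) : A.gen i (A.gen i ξ) = genSign k i • ξ := by
  rcases i with _ | p
  · by_cases h : Odd k <;> simp [gen, genSign, h, A.Γ_Γ]
  · simp [gen, genSign, A.c_c]

variable (k) in
/-- The sign in the commutation relation of two generators. -/
def genComm : Option (Fin k) → Option (Fin k) → ℂ
  | none, none => 1
  | none, some _ => if Odd k then -1 else 1
  | some _, none => if Odd k then -1 else 1
  | some p, some q => if p = q then 1 else -1

theorem genComm_sq (i j : Option (Fin k)) : genComm k i j * genComm k i j = 1 := by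
  rcases i with _ | p <;> rcases j with _ | q <;> simp only [genComm] <;>
    (try split_ifs) <;> norm_num

theorem gen_comm (i j : Option (Fin k)) (ξ : X) :
    A.gen i (A.gen j ξ) = genComm k i j • A.gen j (A.gen i ξ) := by
  rcases i with _ | p <;> rcases j with _ | q
  · simp [genComm]
  · by_cases h : Odd k <;> simp [gen, genComm, h, A.Γ_c_apply]
  · by_cases h : Odd k <;> simp [gen, genComm, h, A.Γ_c_apply]
  · by_cases h : p = q
    · simp [genComm, h]
    · simp [gen, genComm, h, A.c_comm h]

/-- The space of linear maps `S → X` that intertwine Clifford multiplication and, for odd `k`,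
preserve the grading. -/
def homs : Submodule ℂ (SpinModule k →ₗ[ℂ] X) where
  carrier := {w | ∀ i s, w ((spinSystem k).gen i s) = A.gen i (w s)}
  add_mem' hv hw i s := by simp [hv i s, hw i s]
  zero_mem' i s := by simp
  smul_mem' z w hw i s := by simp [hw i s]

/-- Conjugation by a generator on linear maps `S → X`. -/
def conj (i : Option (Fin k)) : Module.End ℂ (SpinModule k →ₗ[ℂ] X) where
  toFun w := genSign k i • (A.gen i ∘ₗ w ∘ₗ (spinSystem k).gen i)
  map_add' v w := by ext s; simp
  map_smul' z w := by ext s; simp [smul_comm z]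

theorem conj_apply (i : Option (Fin k)) (w : SpinModule k →ₗ[ℂ] X) (s : SpinModule k) :
    A.conj i w s = genSign k i • A.gen i (w ((spinSystem k).gen i s)) := rfl

theorem conj_conj (i : Option (Fin k)) (w : SpinModule k →ₗ[ℂ] X) : A.conj i (A.conj i w) = w := by
  refine LinearMap.ext fun s => ?_
  simp only [conj_apply, map_smul, gen_gen, smul_smul, genSign_sq, one_smul]

/-- Exchanging two generators costs the same sign on `X` as on the spin module, so the signs cancel
even where the generators anticommute. -/
theorem conj_comm (i j : Option (Fin k)) (w : SpinModule k →ₗ[ℂ] X) :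
    A.conj i (A.conj j w) = A.conj j (A.conj i w) := by
  refine LinearMap.ext fun s => ?_
  simp only [conj_apply, map_smul]
  rw [A.gen_comm i j, (spinSystem k).gen_comm j i]
  have : genComm k j i = genComm k i j := by
    rcases i with _ | p <;> rcases j with _ | q <;> simp [genComm, eq_comm]
  rw [this]
  simp only [map_smul, smul_smul]
  congr 1
  linear_combination (genSign k i * genSign k j) * genComm_sq i j

/-- Since `genSign k i` times a generator is its inverse, `conj i` is a true conjugation, and its
fixed points are the maps intertwining that generator. Morphisms are thus the common fixed points of
commuting involutions. -/
theorem mem_homs_iff_conj {w : SpinModule k →ₗ[ℂ] X} : w ∈ A.homs ↔ ∀ i, A.conj i w = w := by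
  constructor
  · intro h i
    refine LinearMap.ext fun s => ?_
    rw [conj_apply, h i, gen_gen, smul_smul, genSign_sq, one_smul]
  · intro h i s
    nth_rewrite 1 [← h i]
    rw [conj_apply, gen_gen, map_smul, map_smul, smul_smul, genSign_sq, one_smul]

/-- The projection of the linear maps `S → X` onto the morphisms. -/
def proj : Module.End ℂ (SpinModule k →ₗ[ℂ] X) :=
  averageList A.conj (Finset.univ : Finset (Option (Fin k))).toList

theorem proj_mem (w : SpinModule k →ₗ[ℂ] X) : A.proj w ∈ A.homs :=
  A.mem_homs_iff_conj.2 fun i => averageList_fixed A.conj_comm A.conj_conj (by simp) w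

theorem proj_of_mem {w : SpinModule k →ₗ[ℂ] X} (hw : w ∈ A.homs) : A.proj w = w :=
  averageList_of_fixed _ fun i _ => A.mem_homs_iff_conj.1 hw i

end CliffordSystem

/-! ### Matrix units on the spin module -/

/-- The standard basis vector `e_T` of the spin module. -/
abbrev spinE {k : ℕ} (T : Finset (Fin ((k + 1) / 2))) : SpinModule k := EuclideanSpace.single T 1

theorem spin_eq_sum {k : ℕ} (s : SpinModule k) : s = ∑ T, s T • spinE T := by
  ext T
  simp [Pi.single_apply]

theorem flip_eq_iff {K : ℕ} {j : Fin K} {T T' : Finset (Fin K)} : flip j T = T' ↔ T = flip j T' :=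
  ⟨fun h => by rw [← h, flip_flip], fun h => by rw [h, flip_flip]⟩

theorem gammaOp_spinE {k : ℕ} (p : Fin k) (T : Finset (Fin ((k + 1) / 2))) :
    gammaOp p (spinE T) = gammaCoeff p (flip ⟨(p : ℕ) / 2, by have := p.2; omega⟩ T) •
      spinE (flip ⟨(p : ℕ) / 2, by have := p.2; omega⟩ T) := by
  ext T'
  rw [gammaOp_apply]
  simp only [PiLp.single_apply, PiLp.smul_apply, smul_eq_mul, flip_eq_iff]
  split_ifs with h
  · rw [h]
  · simp

theorem gammaCoeff_ne_zero {k : ℕ} (p : Fin k) (T : Finset (Fin ((k + 1) / 2))) :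
    gammaCoeff p T ≠ 0 := by
  have h : ∀ j, extSign j T ≠ 0 := fun j h => by
    have := extSign_sq j T
    rw [h] at this; simp at this
  unfold gammaCoeff
  simp only
  split_ifs <;> simp [h]

/-- The first of the two basis vectors of `ℝᵏ` that act on the `j`-th factor of the spin module. -/
def evenIdx {k : ℕ} (j : Fin ((k + 1) / 2)) : Fin k := ⟨2 * j, by have := j.2; omega⟩

theorem gammaOp_evenIdx_spinE {k : ℕ} (j : Fin ((k + 1) / 2)) (T : Finset (Fin ((k + 1) / 2))) :
    gammaOp (evenIdx j) (spinE T) = gammaCoeff (evenIdx j) (flip j T) • spinE (flip j T) := by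
  have h : (⟨((evenIdx j : Fin k) : ℕ) / 2, by have := (evenIdx j).2; omega⟩ : Fin ((k + 1) / 2))
      = j := by ext; simp [evenIdx]
  rw [gammaOp_spinE]
  simp only [h]

namespace CliffordSystem

variable {k : ℕ} {X : Type*} [AddCommGroup X] [Module ℂ X] (A : CliffordSystem k X)

/-- Commuting involutions on a graded Clifford module: the operators `-i c_{2j} c_{2j+1}`, and for
odd `k` the grading. -/
def sigma : Option (Fin ((k + 1) / 2)) → Module.End ℂ X
  | none => A.gen none
  | some j => if h : 2 * (j : ℕ) + 1 < k then
      (-Complex.I) • (A.c (evenIdx j) * A.c ⟨2 * j + 1, h⟩) else 1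

theorem sigma_some {j : Fin ((k + 1) / 2)} (h : 2 * (j : ℕ) + 1 < k) (ξ : X) :
    A.sigma (some j) ξ = (-Complex.I) • A.c (evenIdx j) (A.c ⟨2 * j + 1, h⟩ ξ) := by
  simp [sigma, h]

theorem sigma_sigma (i : Option (Fin ((k + 1) / 2))) (ξ : X) : A.sigma i (A.sigma i ξ) = ξ := by
  rcases i with _ | j
  · exact (A.gen_gen none ξ).trans (one_smul _ _)
  · by_cases h : 2 * (j : ℕ) + 1 < k
    · have hne : (⟨2 * j + 1, h⟩ : Fin k) ≠ evenIdx j := by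
        intro h; simpa [evenIdx] using congrArg Fin.val h
      rw [A.sigma_some h, A.sigma_some h]
      simp only [map_smul]
      rw [A.c_comm hne]
      simp only [map_neg, c_c, smul_neg, neg_neg, smul_smul, neg_mul_neg, Complex.I_mul_I]
      simp
    · simp [sigma, h]

/-- Products of two anticommuting generators with disjoint indices commute, as four sign changes
occur. The grading passes such a product with two sign changes. -/
theorem sigma_comm (i j : Option (Fin ((k + 1) / 2))) (ξ : X) :
    A.sigma i (A.sigma j ξ) = A.sigma j (A.sigma i ξ) := by
  have hΓ : ∀ (j : Fin ((k + 1) / 2)) ξ,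
      A.sigma none (A.sigma (some j) ξ) = A.sigma (some j) (A.sigma none ξ) := by
    intro j ξ
    by_cases h : 2 * (j : ℕ) + 1 < k
    · rw [A.sigma_some h, A.sigma_some h]
      by_cases ho : Odd k <;> simp [sigma, gen, ho, Γ_c_apply]
    · simp [sigma, h]
  rcases i with _ | i <;> rcases j with _ | j
  · rfl
  · exact hΓ j ξ
  · exact (hΓ i ξ).symm
  · by_cases hij : i = j
    · rw [hij]
    by_cases hi : 2 * (i : ℕ) + 1 < k
    · by_cases hj : 2 * (j : ℕ) + 1 < k
      · have hij' : (i : ℕ) ≠ j := fun h => hij (Fin.ext h)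
        have h1 : evenIdx i ≠ evenIdx j := by
          intro h; have := congrArg Fin.val h; simp only [evenIdx] at this; omega
        have h2 : evenIdx i ≠ (⟨2 * j + 1, hj⟩ : Fin k) := by
          intro h; have := congrArg Fin.val h; simp only [evenIdx] at this; omega
        have h3 : (⟨2 * i + 1, hi⟩ : Fin k) ≠ evenIdx j := by
          intro h; have := congrArg Fin.val h; simp only [evenIdx] at this; omega
        have h4 : (⟨2 * i + 1, hi⟩ : Fin k) ≠ (⟨2 * j + 1, hj⟩ : Fin k) := by
          intro h; have := congrArg Fin.val h; simp only at this; omega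
        rw [A.sigma_some hi, A.sigma_some hj, A.sigma_some hi, A.sigma_some hj]
        simp only [map_smul]
        rw [A.c_comm h3, A.c_comm h4, map_neg, map_neg, map_neg, A.c_comm h1, A.c_comm h2, map_neg]
        simp
      · simp [sigma, hj]
    · simp [sigma, hi]

end CliffordSystem

/-- The eigenvalue of `sigma (some j)` on `e_T`. -/
def sgn {K : ℕ} (j : Fin K) (T : Finset (Fin K)) : ℂ := if j ∈ T then 1 else -1

theorem sgn_sq {K : ℕ} (j : Fin K) (T : Finset (Fin K)) : sgn j T * sgn j T = 1 := by
  unfold sgn; split_ifs <;> norm_num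

/-- Both factors flip the membership of `j`, so their product is diagonal. The ordering signs square
to one, and only the dependence on `j ∈ T` survives. -/
theorem spinSystem_sigma_some {k : ℕ} {j : Fin ((k + 1) / 2)} (h : 2 * (j : ℕ) + 1 < k)
    (s : SpinModule k) (T) : (spinSystem k).sigma (some j) s T = sgn j T * s T := by
  have h1 : (⟨((evenIdx j : Fin k) : ℕ) / 2, by have := (evenIdx j).2; omega⟩ : Fin ((k + 1) / 2))
      = j := by ext; simp [evenIdx]
  have h2 : (⟨((⟨2 * j + 1, h⟩ : Fin k) : ℕ) / 2, by simp only; omega⟩ : Fin ((k + 1) / 2))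
      = j := by ext; simp only; omega
  rw [CliffordSystem.sigma_some _ h]
  simp only [spinSystem, PiLp.smul_apply, smul_eq_mul, gammaOp_apply, h1, h2, flip_flip]
  have e := extSign_sq j T
  simp only [gammaCoeff, h1, h2, extSign_flip, lt_irrefl, if_false, sgn]
  have h3 : (2 * (j : ℕ) + 1) % 2 ≠ 0 := by omega
  have h4 : ((evenIdx j : Fin k) : ℕ) % 2 = 0 := by simp [evenIdx]
  simp only [h3, h4, if_true, if_false]
  split_ifs
  · linear_combination (-Complex.I * Complex.I * s T) * e - s T * Complex.I_mul_I
  · linear_combination (Complex.I * Complex.I * s T) * e + s T * Complex.I_mul_I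

/-- The matrix unit `s ↦ s_{T'} e_T`. -/
def matUnit {k : ℕ} (T T' : Finset (Fin ((k + 1) / 2))) : Module.End ℂ (SpinModule k) where
  toFun s := s T' • spinE T
  map_add' s t := by simp [add_smul]
  map_smul' z s := by simp [mul_smul]

theorem matUnit_apply {k : ℕ} (T T' : Finset (Fin ((k + 1) / 2))) (s : SpinModule k) :
    matUnit T T' s = s T' • spinE T := rfl

/-- Diagonal operators on the spin module. -/
def diagOp (k : ℕ) : (Finset (Fin ((k + 1) / 2)) → ℂ) →ₐ[ℂ] Module.End ℂ (SpinModule k) where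
  toFun d :=
    { toFun := fun s => WithLp.toLp 2 fun T => d T * s T
      map_add' := fun s t => by ext T; simp; ring
      map_smul' := fun z s => by ext T; simp; ring }
  map_one' := by ext s T; simp
  map_mul' d d' := by ext s T; simp [mul_assoc]
  map_zero' := by ext s T; simp
  map_add' d d' := by ext s T; simp [add_mul]
  commutes' z := by ext s T; simp [Algebra.algebraMap_eq_smul_one]

theorem diagOp_apply {k : ℕ} (d) (s : SpinModule k) (T) : diagOp k d s T = d T * s T := rfl

/-- A subalgebra of functions on a finite type that separates points contains the indicator
functions of points. -/
theorem single_mem_of_separates {I : Type*} [Fintype I] [DecidableEq I]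
    (D : Subalgebra ℂ (I → ℂ)) (hD : ∀ a b, a ≠ b → ∃ d ∈ D, d a ≠ d b) (a : I) :
    Pi.single a 1 ∈ D := by
  have h : ∀ b, ∃ d ∈ D, d a = 1 ∧ (a ≠ b → d b = 0) := by
    intro b
    by_cases hab : a = b
    · exact ⟨1, D.one_mem, rfl, fun h => absurd hab h⟩
    obtain ⟨d, hd, hne⟩ := hD a b hab
    -- Lagrange interpolation: this function is `1` at `a` and `0` at `b`. The product over all `b`
    -- is the indicator of `a`.
    refine ⟨(d a - d b)⁻¹ • (d - algebraMap ℂ _ (d b)),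
      D.smul_mem (D.sub_mem hd (D.algebraMap_mem _)) _, ?_, fun _ => ?_⟩
    · simp [Algebra.algebraMap_eq_smul_one, inv_mul_cancel₀ (sub_ne_zero.2 hne)]
    · simp [Algebra.algebraMap_eq_smul_one]
  choose d hd h1 h0 using h
  have : Pi.single a 1 = ∏ b, d b := by
    ext b
    rw [Finset.prod_apply]
    by_cases hab : a = b
    · subst hab; simp [h1]
    · rw [Pi.single_eq_of_ne (Ne.symm hab)]
      exact (Finset.prod_eq_zero (f := fun c => d c b) (Finset.mem_univ b) (h0 b hab)).symm
  rw [this]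
  exact D.prod_mem fun b _ => hd b

variable (k : ℕ) in
/-- The operators generated by Clifford multiplication and, for odd `k`, the grading. -/
def spinAlgebra : Subalgebra ℂ (Module.End ℂ (SpinModule k)) :=
  Algebra.adjoin ℂ (Set.range (spinSystem k).gen)

theorem gen_mem_spinAlgebra {k : ℕ} (i) : (spinSystem k).gen i ∈ spinAlgebra k :=
  Algebra.subset_adjoin ⟨i, rfl⟩

/-- The generated algebra is therefore all of `End(S)`. Its diagonal operators separate the subsets
`T`, so it contains the projections onto the lines of the `e_T`. Clifford multiplication by
even-indexed vectors then moves any basis vector to any other, up to nonzero factors. -/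
theorem matUnit_mem_spinAlgebra {k : ℕ} (T T' : Finset (Fin ((k + 1) / 2))) :
    matUnit T T' ∈ spinAlgebra k := by
  have hdiag : matUnit T' T' ∈ spinAlgebra k := by
    have h := single_mem_of_separates ((spinAlgebra k).comap (diagOp k)) ?_ T'
    · rw [Subalgebra.mem_comap] at h
      convert h using 1
      ext s S
      simp only [matUnit_apply, diagOp_apply, PiLp.smul_apply, smul_eq_mul,
        PiLp.single_apply, Pi.single_apply]
      split_ifs with h <;> simp [h]
    · intro a b hab
      by_cases hj : ∃ j : Fin ((k + 1) / 2), 2 * (j : ℕ) + 1 < k ∧ sgn j a ≠ sgn j b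
      · obtain ⟨j, hjk, hj⟩ := hj
        refine ⟨sgn j, ?_, hj⟩
        rw [Subalgebra.mem_comap]
        have : diagOp k (sgn j) = (-Complex.I) •
            ((spinSystem k).gen (some (evenIdx j)) * (spinSystem k).gen (some ⟨2 * j + 1, hjk⟩)) := by
          ext s S
          rw [diagOp_apply, ← spinSystem_sigma_some hjk, CliffordSystem.sigma_some _ hjk]
          rfl
        rw [this]
        exact Subalgebra.smul_mem _
          (Subalgebra.mul_mem _ (gen_mem_spinAlgebra _) (gen_mem_spinAlgebra _)) _
      · push Not at hj
        have hmem : ∀ j : Fin ((k + 1) / 2), 2 * (j : ℕ) + 1 < k → (j ∈ a ↔ j ∈ b) := by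
          intro j hjk
          have := hj j hjk
          unfold sgn at this
          split_ifs at this with h1 h2 h2
          · simp [h1, h2]
          · norm_num at this
          · norm_num at this
          · simp [h1, h2]
        have : ∃ j : Fin ((k + 1) / 2), ¬ (j ∈ a ↔ j ∈ b) := by
          by_contra hcon
          push Not at hcon
          exact hab (Finset.ext fun j => (hcon j))
        -- The only index not seen by an operator `-i c_{2j} c_{2j+1}` is the last one for odd `k`,
        -- where `2 * L + 1 = k`. Two subsets that differ only there have opposite parity, so the
        -- grading separates them.
        obtain ⟨L, hL⟩ := this
        have hLk : ¬ 2 * (L : ℕ) + 1 < k := fun h => hL (hmem L h)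
        have hodd : Odd k := by
          have := L.2
          exact ⟨L, by omega⟩
        have hflip : b = flip L a := by
          ext i
          rw [mem_flip]
          split_ifs with hi
          · subst hi; tauto
          · refine (hmem i ?_).symm
            have := L.2; have := i.2
            have : (i : ℕ) ≠ L := fun h => hi (Fin.ext h)
            omega
        refine ⟨fun S => (-1) ^ S.card, ?_, ?_⟩
        · rw [Subalgebra.mem_comap]
          have : diagOp k (fun S => (-1) ^ S.card) = (spinSystem k).gen none := by
            ext s S
            simp [CliffordSystem.gen, hodd, diagOp_apply, spinSystem, spinGrading_apply]
          rw [this]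
          exact gen_mem_spinAlgebra _
        · simp only [hflip, neg_one_pow_card_flip]
          intro h
          have h2 : (-1 : ℂ) ^ a.card ≠ 0 := pow_ne_zero _ (by norm_num)
          exact h2 (self_eq_neg.1 h)
  -- `C` is the set of indices already flipped. Taking `C = symmDiff T' T` at the end reaches `T`.
  have key : ∀ C : Finset (Fin ((k + 1) / 2)), matUnit (symmDiff T' C) T' ∈ spinAlgebra k := by
    intro C
    induction C using Finset.induction_on with
    | empty => rwa [← Finset.bot_eq_empty, symmDiff_bot]
    | insert j C hj ih =>
      have h1 : symmDiff T' (insert j C) = flip j (symmDiff T' C) := by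
        have : insert j C = symmDiff C {j} := by
          ext i
          simp only [Finset.mem_insert, Finset.mem_symmDiff, Finset.mem_singleton]
          by_cases hi : i = j <;> simp_all
        rw [flip, symmDiff_assoc, this]
      have h2 : matUnit (symmDiff T' (insert j C)) T' =
          (gammaCoeff (evenIdx j) (flip j (symmDiff T' C)))⁻¹ •
            ((spinSystem k).gen (some (evenIdx j)) * matUnit (symmDiff T' C) T') := by
        refine LinearMap.ext fun s => ?_
        simp only [LinearMap.smul_apply, Module.End.mul_apply, matUnit_apply, map_smul,
          CliffordSystem.gen_some]
        change _ = _ • s T' • gammaOp (evenIdx j) (spinE _)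
        rw [gammaOp_evenIdx_spinE, h1, smul_comm (s T'), smul_smul,
          inv_mul_cancel₀ (gammaCoeff_ne_zero _ _), one_smul]
      rw [h2]
      exact Subalgebra.smul_mem _ (Subalgebra.mul_mem _ (gen_mem_spinAlgebra _) ih) _
  have := key (symmDiff T' T)
  rwa [symmDiff_symmDiff_cancel_left] at this

namespace CliffordSystem

variable {k : ℕ} {X : Type*} [AddCommGroup X] [Module ℂ X] (A : CliffordSystem k X)

/-- The same polynomial in the generators, formed on `X`, serves all morphisms at once. This lets
matrix units be applied to sums over different morphisms. -/
theorem exists_intertwined {B : Module.End ℂ (SpinModule k)} (hB : B ∈ spinAlgebra k) :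
    ∃ C : Module.End ℂ X, ∀ w ∈ A.homs, ∀ s, w (B s) = C (w s) := by
  refine Algebra.adjoin_induction (p := fun B _ => ∃ C : Module.End ℂ X, ∀ w ∈ A.homs, ∀ s,
    w (B s) = C (w s)) ?_ ?_ ?_ ?_ hB
  · rintro _ ⟨i, rfl⟩
    exact ⟨A.gen i, fun w hw => hw i⟩
  · exact fun z => ⟨algebraMap ℂ _ z, fun w _ s => by simp [Algebra.algebraMap_eq_smul_one]⟩
  · rintro B B' _ _ ⟨C, hC⟩ ⟨C', hC'⟩
    exact ⟨C + C', fun w hw s => by simp [hC w hw, hC' w hw]⟩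
  · rintro B B' _ _ ⟨C, hC⟩ ⟨C', hC'⟩
    exact ⟨C * C', fun w hw s => by simp [hC w hw, hC' w hw]⟩

/-- Evaluation of morphisms. -/
def eval : SpinModule k ⊗[ℂ] A.homs →ₗ[ℂ] X :=
  TensorProduct.lift (LinearMap.flip A.homs.subtype)

theorem eval_tmul (s : SpinModule k) (w : A.homs) : A.eval (s ⊗ₜ w) = w.1 s := rfl

/-- An element `∑ e_T ⊗ w_T` of the kernel has `∑ w_T e_T = 0`. The counterparts on `X` of the
matrix units isolate each `w_T` and evaluate it on every basis vector. -/
theorem eval_injective : Function.Injective A.eval := by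
  rw [injective_iff_map_eq_zero]
  intro z hz
  have hex : ∃ w : Finset (Fin ((k + 1) / 2)) → A.homs, z = ∑ T, spinE T ⊗ₜ[ℂ] w T := by
    clear hz
    induction z using TensorProduct.induction_on with
    | zero => exact ⟨0, by simp⟩
    | tmul s w =>
      refine ⟨fun T => s T • w, ?_⟩
      conv_lhs => rw [spin_eq_sum s]
      simp [TensorProduct.sum_tmul, TensorProduct.smul_tmul]
    | add x y hx hy =>
      obtain ⟨v, rfl⟩ := hx
      obtain ⟨w, rfl⟩ := hy
      exact ⟨v + w, by simp [TensorProduct.tmul_add, Finset.sum_add_distrib]⟩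
  obtain ⟨w, rfl⟩ := hex
  simp only [map_sum, eval_tmul] at hz
  have h0 : ∀ T T', (w T).1 (spinE T') = 0 := by
    intro T T'
    obtain ⟨C, hC⟩ := A.exists_intertwined (matUnit_mem_spinAlgebra T' T)
    have h := congrArg C hz
    rw [map_sum, map_zero] at h
    simp only [← hC _ (w _).2, matUnit_apply, PiLp.single_apply, ite_smul,
      one_smul, zero_smul] at h
    rw [Finset.sum_eq_single T (fun T'' _ hT => by rw [if_neg (Ne.symm hT), map_zero]) (by simp),
      if_pos rfl] at h
    exact h
  refine Finset.sum_eq_zero fun T _ => ?_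
  have : w T = 0 := by
    ext1
    refine LinearMap.ext fun s => ?_
    rw [spin_eq_sum s, map_sum]
    simp [h0]
  rw [this, TensorProduct.tmul_zero]

theorem conj_spinE (j : Fin ((k + 1) / 2)) (w : SpinModule k →ₗ[ℂ] X) (T) :
    A.conj (some (evenIdx j)) w (spinE T) =
      (-gammaCoeff (evenIdx j) (flip j T)) • A.c (evenIdx j) (w (spinE (flip j T))) := by
  rw [conj_apply, gen_some, gen_some]
  change _ • A.c _ (w (gammaOp _ _)) = _
  rw [gammaOp_evenIdx_spinE, map_smul, map_smul, smul_smul]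
  simp [genSign]

/-- The map `s ↦ s_T ξ`. -/
def rankOne (T : Finset (Fin ((k + 1) / 2))) (ξ : X) : SpinModule k →ₗ[ℂ] X where
  toFun s := s T • ξ
  map_add' s t := by simp [add_smul]
  map_smul' z s := by simp [mul_smul]

theorem rankOne_apply (T : Finset (Fin ((k + 1) / 2))) (ξ : X) (s : SpinModule k) :
    rankOne T ξ s = s T • ξ := rfl

/-- Conjugation by an even-indexed generator moves the support of a map from `T` to `flip j T`.
After averaging over `l`, the map lives on subsets agreeing with `T` outside `l`. A new index `i ∉
l` therefore contributes nothing at `e_T` beyond the factor `1 / 2`. -/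
theorem average_rankOne (T : Finset (Fin ((k + 1) / 2))) (ξ : X) (l : List (Fin ((k + 1) / 2)))
    (hl : l.Nodup) :
    (∀ T', (∃ j, j ∉ l ∧ ¬ (j ∈ T' ↔ j ∈ T)) →
      averageList (fun j => A.conj (some (evenIdx j))) l (rankOne T ξ) (spinE T') = 0) ∧
    averageList (fun j => A.conj (some (evenIdx j))) l (rankOne T ξ) (spinE T) =
      ((1 / 2 : ℂ) ^ l.length) • ξ := by
  induction l with
  | nil =>
    refine ⟨fun T' ⟨j, _, hj⟩ => ?_, ?_⟩
    · rw [averageList_nil, rankOne_apply, PiLp.single_apply, if_neg, zero_smul]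
      rintro rfl; exact hj Iff.rfl
    · rw [averageList_nil, rankOne_apply]; simp
  | cons i l ih =>
    obtain ⟨h0, h1⟩ := ih (List.nodup_cons.1 hl).2
    have hil := (List.nodup_cons.1 hl).1
    refine ⟨fun T' ⟨j, hj, hT⟩ => ?_, ?_⟩
    · rw [List.mem_cons, not_or] at hj
      rw [averageList_cons, LinearMap.smul_apply, LinearMap.add_apply, conj_spinE,
        h0 T' ⟨j, hj.2, hT⟩, h0 (flip i T') ⟨j, hj.2, by rw [mem_flip, if_neg hj.1]; exact hT⟩]
      simp
    · rw [averageList_cons, LinearMap.smul_apply, LinearMap.add_apply, conj_spinE, h1,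
        h0 (flip i T) ⟨i, hil, by rw [mem_flip, if_pos rfl]; tauto⟩]
      simp [pow_succ, smul_smul, mul_comm]

/-- Choose `T` so that `e_T` has the eigenvalues of `ξ`, and average `s ↦ s_T ξ` over the
even-indexed generators alone. Equality of the eigenvalues makes invariance under the remaining
generators automatic, and the value at `e_T` is a nonzero multiple of `ξ`. -/
theorem mem_range_eval_of_eigenvector (ξ : X)
    (hξ : ∀ i, A.sigma i ξ = ξ ∨ A.sigma i ξ = -ξ) : ξ ∈ LinearMap.range A.eval := by
  classical
  obtain ⟨T, hT1, hT2⟩ : ∃ T : Finset (Fin ((k + 1) / 2)),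
      (∀ j : Fin ((k + 1) / 2), 2 * (j : ℕ) + 1 < k → A.sigma (some j) ξ = sgn j T • ξ) ∧
      (Odd k → A.Γ ξ = (-1 : ℂ) ^ T.card • ξ) := by
    -- The indices with eigenvalue `+1`, matching `sgn`. For odd `k` the last index is left out and
    -- remains free to adjust the parity.
    let T0 : Finset (Fin ((k + 1) / 2)) :=
      Finset.univ.filter fun j => 2 * (j : ℕ) + 1 < k ∧ A.sigma (some j) ξ = ξ
    have h0 : ∀ j : Fin ((k + 1) / 2), 2 * (j : ℕ) + 1 < k → A.sigma (some j) ξ = sgn j T0 • ξ := by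
      intro j hj
      unfold sgn
      split_ifs with h
      · rw [one_smul]; exact (Finset.mem_filter.1 h).2.2
      · have : ¬ A.sigma (some j) ξ = ξ := fun h' => h (by simp [T0, hj, h'])
        rw [neg_smul, one_smul]; exact (hξ (some j)).resolve_left this
    by_cases ho : Odd k
    · have hΓ : A.Γ ξ = ξ ∨ A.Γ ξ = -ξ := by simpa [sigma, gen, ho] using hξ none
      by_cases hp : A.Γ ξ = (-1 : ℂ) ^ T0.card • ξ
      · exact ⟨T0, h0, fun _ => hp⟩
      · obtain ⟨r, hr⟩ := ho
        -- The last index, with `2 * L + 1 = k`. Flipping it reverses the eigenvalue of the grading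
        -- and leaves the other eigenvalues alone.
        let L : Fin ((k + 1) / 2) := ⟨r, by omega⟩
        refine ⟨flip L T0, fun j hj => ?_, fun _ => ?_⟩
        · have : j ≠ L := by rintro rfl; simp only [L] at hj; omega
          rw [h0 j hj]
          simp [sgn, mem_flip, this]
        · rw [neg_one_pow_card_flip]
          rcases neg_one_pow_eq_or ℂ T0.card with h | h <;> rw [h] at hp ⊢ <;>
            rcases hΓ with h' | h' <;> simp_all
    · exact ⟨T0, h0, fun h => absurd h ho⟩
  set R : Fin ((k + 1) / 2) → Module.End ℂ (SpinModule k →ₗ[ℂ] X) :=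
    fun j => A.conj (some (evenIdx j)) with hR
  have hcomm : ∀ i j w, R i (R j w) = R j (R i w) := fun i j => A.conj_comm _ _
  set l := (Finset.univ : Finset (Fin ((k + 1) / 2))).toList with hl
  have hcl : ∀ i w, A.conj i (averageList R l w) = averageList R l (A.conj i w) := by
    intro i w
    induction l with
    | nil => simp [averageList_nil]
    | cons j l ih => rw [averageList_cons, averageList_cons, map_smul, map_add, A.conj_comm i, ih]
  have hfix : ∀ j w, R j (averageList R l w) = averageList R l w := fun j w =>
    averageList_fixed hcomm (fun i => A.conj_conj _) (by simp [hl]) w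
  have hmem : averageList R l (rankOne T ξ) ∈ A.homs := by
    rw [mem_homs_iff_conj]
    rintro (_ | p)
    · rw [hcl]
      congr 1
      refine LinearMap.ext fun s => ?_
      by_cases ho : Odd k
      · simp only [conj_apply, gen, ho, if_true, rankOne_apply, map_smul, hT2 ho, genSign,
          smul_smul]
        change (1 * ((-1) ^ T.card * s T * (-1) ^ T.card)) • ξ = _
        rw [one_mul, mul_right_comm, ← mul_pow]; norm_num
      · simp [conj_apply, gen, ho, rankOne_apply, genSign]
    · rcases Nat.even_or_odd' (p : ℕ) with ⟨r, hr | hr⟩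
      · have : p = evenIdx (⟨r, by have := p.2; omega⟩ : Fin ((k + 1) / 2)) := by
          ext; simp [evenIdx, hr]
        rw [this]
        exact hfix _ _
      · set j : Fin ((k + 1) / 2) := ⟨r, by have := p.2; omega⟩ with hj
        have hjk : 2 * (j : ℕ) + 1 < k := by have := p.2; simp only [hj]; omega
        have hp : p = ⟨2 * j + 1, hjk⟩ := by ext; simp [hj, hr]
        have hne : p ≠ evenIdx j := by
          intro h; have := congrArg Fin.val h; simp only [evenIdx, hj] at this; omega
        -- This is conjugation by `c_{2j} c_{2j+1}`, which acts on `ξ` and on `e_T` by the same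
        -- scalar `i * sgn j T`. Hence conjugation by the odd-indexed generator agrees with `R j` on
        -- this map.
        have h1 : R j (A.conj (some p) (rankOne T ξ)) = rankOne T ξ := by
          refine LinearMap.ext fun s => ?_
          have e1 := hT1 j hjk
          rw [A.sigma_some hjk, ← hp] at e1
          have e2 := spinSystem_sigma_some hjk s T
          rw [CliffordSystem.sigma_some _ hjk, ← hp] at e2
          have e1' : A.c (evenIdx j) (A.c p ξ) = (Complex.I * sgn j T) • ξ := by
            rw [mul_smul, ← e1, smul_smul]; simp
          have e2' : ((spinSystem k).c (evenIdx j) ((spinSystem k).c p s)) T =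
              Complex.I * (sgn j T * s T) := by
            rw [← e2]; simp only [PiLp.smul_apply, smul_eq_mul]
            linear_combination (((spinSystem k).c (evenIdx j) ((spinSystem k).c p s)) T) *
              Complex.I_mul_I
          simp only [hR, conj_apply, gen_some, genSign, rankOne_apply, map_smul]
          rw [(spinSystem k).c_comm hne, PiLp.neg_apply, e1', e2']
          simp only [smul_smul]
          congr 1
          linear_combination (-(s T) * sgn j T * sgn j T) * Complex.I_mul_I + s T * sgn_sq j T
        have h2 : A.conj (some p) (rankOne T ξ) = R j (rankOne T ξ) := by
          rw [← congrArg (R j) h1]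
          exact (A.conj_conj _ _).symm
        rw [hcl, h2, ← averageList_comm hcomm, hfix]
  obtain ⟨-, h1⟩ := A.average_rankOne T ξ l (Finset.nodup_toList _)
  have h2 : (1 / 2 : ℂ) ^ l.length ≠ 0 := pow_ne_zero _ (by norm_num)
  refine ⟨((1 / 2 : ℂ) ^ l.length)⁻¹ • (spinE T ⊗ₜ ⟨_, hmem⟩), ?_⟩
  rw [map_smul, eval_tmul]
  change _ • averageList R l (rankOne T ξ) (spinE T) = ξ
  rw [h1, smul_smul, inv_mul_cancel₀ h2, one_smul]

theorem eval_surjective : Function.Surjective A.eval := by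
  rw [← LinearMap.range_eq_top, eq_top_iff,
    ← span_joint_eigenvectors A.sigma_comm A.sigma_sigma Finset.univ.toList, Submodule.span_le]
  exact fun ξ hξ => A.mem_range_eval_of_eigenvector ξ fun i => hξ i (by simp)

/-- A graded Clifford module is the tensor product of the spin module and its multiplicity space. -/
def evalEquiv : (SpinModule k ⊗[ℂ] A.homs) ≃ₗ[ℂ] X :=
  LinearEquiv.ofBijective A.eval ⟨A.eval_injective, A.eval_surjective⟩

end CliffordSystem

/-! ### Unitarity -/

theorem spinModule_inner {k : ℕ} (s t : SpinModule k) :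
    inner ℂ s t = ∑ T, star (s T) * t T := by
  simp [PiLp.inner_apply, mul_comm]

theorem inner_spinE {k : ℕ} (s : SpinModule k) (T) : inner ℂ s (spinE T) = star (s T) := by
  rw [spinModule_inner]
  simp [PiLp.single_apply]

theorem spinE_inner {k : ℕ} (s : SpinModule k) (T) : inner ℂ (spinE T) s = s T := by
  rw [← inner_conj_symm, inner_spinE]
  simp

theorem map_eq_sum {k : ℕ} {X : Type*} [AddCommGroup X] [Module ℂ X] (w : SpinModule k →ₗ[ℂ] X)
    (s : SpinModule k) : w s = ∑ T, s T • w (spinE T) := by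
  conv_lhs => rw [spin_eq_sum s, map_sum]
  simp only [map_smul]

theorem inner_map_map {k : ℕ} {X : Type*} [NormedAddCommGroup X] [InnerProductSpace ℂ X]
    (v w : SpinModule k →ₗ[ℂ] X) (s t : SpinModule k) :
    inner ℂ (v s) (w t) =
      ∑ S, ∑ S', star (s S) * t S' * inner ℂ (v (spinE S)) (w (spinE S')) := by
  rw [map_eq_sum v s, map_eq_sum w t, sum_inner]
  refine Finset.sum_congr rfl fun S _ => ?_
  rw [inner_sum]
  refine Finset.sum_congr rfl fun S' _ => ?_
  rw [inner_smul_left, inner_smul_right, mul_assoc]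
  rfl

theorem star_extSign {K : ℕ} (j : Fin K) (T : Finset (Fin K)) :
    star (extSign j T) = extSign j T := by
  simp [extSign]

/-- The operator pairs `T` only with `flip j T`, and the two coefficients of the pair are negative
conjugates. Reindexing the sum by `flip j` gives skewness. -/
theorem gammaOp_skew {k : ℕ} (p : Fin k) (s t : SpinModule k) :
    inner ℂ (gammaOp p s) t = -inner ℂ s (gammaOp p t) := by
  set j : Fin ((k + 1) / 2) := ⟨(p : ℕ) / 2, by have := p.2; omega⟩ with hj
  have hc : ∀ T, star (gammaCoeff p (flip j T)) = -gammaCoeff p T := by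
    intro T
    simp only [gammaCoeff, ← hj, extSign_flip, lt_irrefl, if_false, mem_flip, if_true]
    split_ifs <;> simp_all [star_extSign]
  rw [spinModule_inner, spinModule_inner, ← Finset.sum_neg_distrib,
    ← Equiv.sum_comp (Function.Involutive.toPerm (flip j) (flip_flip j))]
  refine Finset.sum_congr rfl fun T _ => ?_
  change star (gammaOp p s (flip j T)) * t (flip j T) = _
  simp only [gammaOp_apply, ← hj, flip_flip, star_mul', hc]
  ring

theorem spinGrading_symm {k : ℕ} (s t : SpinModule k) :
    inner ℂ (spinGrading k s) t = inner ℂ s (spinGrading k t) := by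
  rw [spinModule_inner, spinModule_inner]
  refine Finset.sum_congr rfl fun T _ => ?_
  simp only [spinGrading_apply, star_mul', star_pow, star_neg, star_one]
  ring

theorem gammaVec_apply {k : ℕ} (a : Fin k → ℝ) (s : SpinModule k) :
    gammaVec k a s = ∑ p, (a p : ℂ) • gammaOp p s := by
  simp [gammaVec, Fintype.linearCombination_apply]

theorem gammaVec_single {k : ℕ} (p : Fin k) : gammaVec k (Pi.single p 1) = gammaOp p := by
  simp [gammaVec, Fintype.linearCombination_apply_single]

theorem gammaVec_skew {k : ℕ} (a : Fin k → ℝ) (s t : SpinModule k) :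
    inner ℂ (gammaVec k a s) t = -inner ℂ s (gammaVec k a t) := by
  simp only [gammaVec_apply, sum_inner, inner_sum, inner_smul_left, inner_smul_right, gammaOp_skew,
    Complex.conj_ofReal, ← Finset.sum_neg_distrib, mul_neg]

theorem spinGrading_gammaVec {k : ℕ} (a : Fin k → ℝ) (s : SpinModule k) :
    spinGrading k (gammaVec k a s) = -gammaVec k a (spinGrading k s) := by
  simp only [gammaVec_apply, map_sum, map_smul, ← Finset.sum_neg_distrib, ← smul_neg]
  exact Finset.sum_congr rfl fun p _ => congrArg _ ((spinSystem k).Γ_c_apply p s)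

theorem spinRep_ι {k : ℕ} (a : Fin k → ℝ) :
    spinRep k (CliffordAlgebra.ι (Q k) a) = gammaVec k a := by
  simp [spinRep]

/-- Both `star` and the adjoint reverse products and negate vectors. On `Spin(k)`, where `star` is
the inverse, this is unitarity. -/
theorem spinRep_star {k : ℕ} (a : Cl k) (s t : SpinModule k) :
    inner ℂ (spinRep k a s) t = inner ℂ s (spinRep k (star a) t) := by
  induction a using CliffordAlgebra.induction generalizing s t with
  | algebraMap r =>
    rw [CliffordAlgebra.star_algebraMap, AlgHom.commutes, Algebra.algebraMap_eq_smul_one]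
    simp only [LinearMap.smul_apply, Module.End.one_apply]
    rw [← Complex.coe_smul, ← Complex.coe_smul, inner_smul_left, inner_smul_right,
      Complex.conj_ofReal]
  | ι a =>
    rw [CliffordAlgebra.star_ι, map_neg, spinRep_ι, gammaVec_skew, LinearMap.neg_apply,
      inner_neg_right]
  | mul a b ha hb =>
    rw [star_mul, map_mul, map_mul, Module.End.mul_apply, Module.End.mul_apply, ha, hb]
  | add a b ha hb =>
    rw [star_add, map_add, map_add, LinearMap.add_apply, LinearMap.add_apply, inner_add_left,
      inner_add_right, ha, hb]

/-- The grading anticommutes with vectors, so conjugation by it implements the grade involution. In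
particular it commutes with the even group `Spin(k)`. -/
theorem spinRep_involute {k : ℕ} (a : Cl k) (s : SpinModule k) :
    spinGrading k (spinRep k a s) =
      spinRep k (CliffordAlgebra.involute a) (spinGrading k s) := by
  induction a using CliffordAlgebra.induction generalizing s with
  | algebraMap r =>
    rw [AlgHom.commutes CliffordAlgebra.involute, AlgHom.commutes, Algebra.algebraMap_eq_smul_one]
    simp only [LinearMap.smul_apply, Module.End.one_apply]
    rw [← Complex.coe_smul, map_smul, Complex.coe_smul]
  | ι a =>
    rw [CliffordAlgebra.involute_ι, map_neg, spinRep_ι, LinearMap.neg_apply, spinGrading_gammaVec]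
  | mul a b ha hb =>
    rw [map_mul, map_mul, map_mul, Module.End.mul_apply, Module.End.mul_apply, ha, hb]
  | add a b ha hb =>
    rw [map_add, map_add, map_add, LinearMap.add_apply, LinearMap.add_apply, map_add, ha, hb]

section SpinGroup

variable {k : ℕ} (g : Spin k)

theorem spin_mul_inv : (g : Cl k) * ((g⁻¹ : Spin k) : Cl k) = 1 := by
  rw [← Submonoid.coe_mul, mul_inv_cancel, Submonoid.coe_one]

theorem spin_inv_mul : ((g⁻¹ : Spin k) : Cl k) * (g : Cl k) = 1 := by
  rw [← Submonoid.coe_mul, inv_mul_cancel, Submonoid.coe_one]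

theorem spinRep_spin_inv (s : SpinModule k) :
    spinRep k g (spinRep k ((g⁻¹ : Spin k) : Cl k) s) = s := by
  rw [← Module.End.mul_apply, ← map_mul, spin_mul_inv, map_one, Module.End.one_apply]

theorem spinRep_inv_spin (s : SpinModule k) :
    spinRep k ((g⁻¹ : Spin k) : Cl k) (spinRep k g s) = s := by
  rw [← Module.End.mul_apply, ← map_mul, spin_inv_mul, map_one, Module.End.one_apply]

theorem spinRep_spin_adjoint (s t : SpinModule k) :
    inner ℂ (spinRep k g s) t = inner ℂ s (spinRep k ((g⁻¹ : Spin k) : Cl k) t) := by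
  rw [spinRep_star, ← spinGroup.star_eq_inv, spinGroup.coe_star]

theorem spinGrading_spinRep_spin (s : SpinModule k) :
    spinGrading k (spinRep k g s) = spinRep k g (spinGrading k s) := by
  rw [spinRep_involute, spinGroup.involute_eq g.2]

theorem spinRep_gammaVec (a : Fin k → ℝ) (s : SpinModule k) :
    spinRep k g (gammaVec k a s) = gammaVec k (spinRot g a) (spinRep k g s) := by
  rw [← spinRep_ι, ← spinRep_ι, ι_spinRot, ← Module.End.mul_apply, ← Module.End.mul_apply,
    ← map_mul, ← map_mul, mul_assoc, spin_inv_mul, mul_one]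

/-- The group `Spin(k)` acts unitarily on the spin module. -/
theorem sum_inner_spinRep {X : Type*} [NormedAddCommGroup X] [InnerProductSpace ℂ X]
    (v w : SpinModule k →ₗ[ℂ] X) :
    ∑ T, inner ℂ (v (spinRep k g (spinE T))) (w (spinRep k g (spinE T))) =
      ∑ T, inner ℂ (v (spinE T)) (w (spinE T)) := by
  -- Orthonormality of the rows of the matrix of `g`, obtained by reading the entries of `g` as
  -- conjugates of those of `g⁻¹`. The Hilbert-Schmidt sum is thus independent of the orthonormal
  -- basis.
  have h2 : ∀ S S' : Finset (Fin ((k + 1) / 2)),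
      ∑ T, star (spinRep k g (spinE T) S) * spinRep k g (spinE T) S' = if S = S' then 1 else 0 := by
    intro S S'
    have h : ∀ T S, spinRep k g (spinE T) S =
        star (spinRep k ((g⁻¹ : Spin k) : Cl k) (spinE S) T) := by
      intro T S
      have := spinRep_spin_adjoint g (spinE T) (spinE S)
      rw [inner_spinE, spinE_inner] at this
      rw [← this, star_star]
    have hi := spinRep_spin_adjoint (g⁻¹) (spinE S') (spinRep k ((g⁻¹ : Spin k) : Cl k) (spinE S))
    rw [inv_inv, spinRep_spin_inv, spinE_inner, spinModule_inner] at hi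
    simp only [h, star_star]
    rw [Finset.sum_congr rfl fun T _ => mul_comm _ _, hi, PiLp.single_apply]
    simp only [eq_comm]
  calc _ = ∑ S, ∑ S', (∑ T, star (spinRep k g (spinE T) S) * spinRep k g (spinE T) S') *
        inner ℂ (v (spinE S)) (w (spinE S')) := by
        simp only [inner_map_map v w (spinRep k g _), Finset.sum_mul]
        rw [Finset.sum_comm]
        exact Finset.sum_congr rfl fun S _ => Finset.sum_comm
    _ = _ := by
        simp only [h2, ite_mul, one_mul, zero_mul, Finset.sum_ite_eq, Finset.mem_univ, if_true]

end SpinGroup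

namespace CliffordSystem

variable {k : ℕ} {X : Type*} [NormedAddCommGroup X] [InnerProductSpace ℂ X]
  (A : CliffordSystem k X)

/-- Generators have formally the same adjoints on `S` and on `X`, so one `B'` works on both sides.
The first clause identifies `B'` as the true adjoint on `S`, and the second transports it through
morphisms. -/
theorem exists_adjoint (hc : ∀ p ξ η, inner ℂ (A.c p ξ) η = -inner ℂ ξ (A.c p η))
    (hΓ : ∀ ξ η, inner ℂ (A.Γ ξ) η = inner ℂ ξ (A.Γ η)) {B : Module.End ℂ (SpinModule k)}
    (hB : B ∈ spinAlgebra k) :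
    ∃ B' : Module.End ℂ (SpinModule k), (∀ s t, inner ℂ (B s) t = inner ℂ s (B' t)) ∧
      ∀ v ∈ A.homs, ∀ w ∈ A.homs, ∀ s t, inner ℂ (v (B s)) (w t) = inner ℂ (v s) (w (B' t)) := by
  refine Algebra.adjoin_induction (p := fun B _ => ∃ B' : Module.End ℂ (SpinModule k),
    (∀ s t, inner ℂ (B s) t = inner ℂ s (B' t)) ∧
      ∀ v ∈ A.homs, ∀ w ∈ A.homs, ∀ s t, inner ℂ (v (B s)) (w t) = inner ℂ (v s) (w (B' t)))
    ?_ ?_ ?_ ?_ hB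
  · rintro _ ⟨i, rfl⟩
    rcases i with _ | p
    · refine ⟨(spinSystem k).gen none, ?_, fun v hv w hw s t => ?_⟩
      · by_cases ho : Odd k
        · simp only [gen, ho, if_true]; exact spinGrading_symm
        · simp [gen, ho]
      · rw [hv, hw]
        by_cases ho : Odd k
        · simp only [gen, ho, if_true, hΓ]
        · simp [gen, ho]
    · refine ⟨-(spinSystem k).gen (some p), fun s t => ?_, fun v hv w hw s t => ?_⟩
      · rw [LinearMap.neg_apply, inner_neg_right]; exact gammaOp_skew p s t
      · rw [LinearMap.neg_apply, map_neg, hv, hw, inner_neg_right]; exact hc _ _ _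
  · refine fun z => ⟨algebraMap ℂ _ (star z), fun s t => ?_, fun v _ w _ s t => ?_⟩
    · simp [Algebra.algebraMap_eq_smul_one, mul_comm]
    · simp [Algebra.algebraMap_eq_smul_one, mul_comm]
  · rintro B C _ _ ⟨B', h1, h2⟩ ⟨C', h3, h4⟩
    refine ⟨B' + C', fun s t => ?_, fun v hv w hw s t => ?_⟩
    · simp [h1, h3]
    · simp [h2 v hv w hw, h4 v hv w hw]
  · rintro B C _ _ ⟨B', h1, h2⟩ ⟨C', h3, h4⟩
    refine ⟨C' * B', fun s t => ?_, fun v hv w hw s t => ?_⟩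
    · simp [h1, h3]
    · simp [h2 v hv w hw, h4 v hv w hw]

/-- A Schur orthogonality relation: write `e_T` as a matrix unit applied to `e_∅` and move the
matrix unit across the product as its adjoint. The choice of `∅` as base point is arbitrary. -/
theorem inner_hom_spinE (hc : ∀ p ξ η, inner ℂ (A.c p ξ) η = -inner ℂ ξ (A.c p η))
    (hΓ : ∀ ξ η, inner ℂ (A.Γ ξ) η = inner ℂ ξ (A.Γ η)) {v w : SpinModule k →ₗ[ℂ] X}
    (hv : v ∈ A.homs) (hw : w ∈ A.homs) (T T') :
    inner ℂ (v (spinE T)) (w (spinE T')) =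
      if T = T' then inner ℂ (v (spinE ∅)) (w (spinE ∅)) else 0 := by
  obtain ⟨B', h1, h2⟩ := A.exists_adjoint hc hΓ (matUnit_mem_spinAlgebra T ∅)
  have hB' : ∀ t, B' t = matUnit ∅ T t := by
    refine fun t => ext_inner_left ℂ fun s => ?_
    rw [← h1, matUnit_apply, matUnit_apply, inner_smul_left, inner_smul_right,
      spinE_inner, inner_spinE, mul_comm]
    rfl
  have h := h2 v hv w hw (spinE ∅) (spinE T')
  rw [hB', matUnit_apply, matUnit_apply] at h
  simp only [PiLp.single_apply, if_true, one_smul] at h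
  rw [h]
  split_ifs <;> simp

/-- Morphisms into a unitary Clifford module are isometric up to scale, in a sesquilinear sense. -/
theorem inner_hom (hc : ∀ p ξ η, inner ℂ (A.c p ξ) η = -inner ℂ ξ (A.c p η))
    (hΓ : ∀ ξ η, inner ℂ (A.Γ ξ) η = inner ℂ ξ (A.Γ η)) {v w : SpinModule k →ₗ[ℂ] X}
    (hv : v ∈ A.homs) (hw : w ∈ A.homs) (s t : SpinModule k) :
    (2 : ℂ) ^ ((k + 1) / 2) * inner ℂ (v s) (w t) =
      inner ℂ s t * ∑ T, inner ℂ (v (spinE T)) (w (spinE T)) := by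
  have h1 : ∑ T : Finset (Fin ((k + 1) / 2)), inner ℂ (v (spinE T)) (w (spinE T)) =
      (2 : ℂ) ^ ((k + 1) / 2) * inner ℂ (v (spinE ∅)) (w (spinE ∅)) := by
    rw [Finset.sum_congr rfl fun T _ =>
      (A.inner_hom_spinE hc hΓ hv hw T T).trans (if_pos rfl), Finset.sum_const, nsmul_eq_mul]
    simp
  have h2 : inner ℂ (v s) (w t) = inner ℂ s t * inner ℂ (v (spinE ∅)) (w (spinE ∅)) := by
    rw [inner_map_map, spinModule_inner, Finset.sum_mul]
    refine Finset.sum_congr rfl fun T _ => ?_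
    rw [Finset.sum_eq_single T]
    · rw [A.inner_hom_spinE hc hΓ hv hw, if_pos rfl]
    · intro T' _ h
      rw [A.inner_hom_spinE hc hΓ hv hw, if_neg (Ne.symm h), mul_zero]
    · simp
  rw [h1, h2]; ring

end CliffordSystem

set_option linter.unusedSectionVars false

/-! ### Sections of vector bundles along maps -/

section Expansion

variable {B : Type*} [TopologicalSpace B] {F : Type*} [NormedAddCommGroup F] [NormedSpace ℝ F]
  [FiniteDimensional ℝ F] {E : B → Type*} [∀ x, AddCommGroup (E x)] [∀ x, Module ℝ (E x)]
  [∀ x, TopologicalSpace (E x)] [TopologicalSpace (TotalSpace F E)] [FiberBundle F E]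
  [VectorBundle ℝ F E]

variable (F E) in
/-- The sections of the local frame given by the preferred trivialization at `x₀`. -/
def stdFrame (x₀ : B) (i : Fin (finrank ℝ F)) (x : B) : E x :=
  (trivializationAt F E x₀).localFrame (finBasis ℝ F) i x

/-- The coordinates of a vector in the preferred trivialization at `x₀`. -/
def stdCoord (x₀ : B) (i : Fin (finrank ℝ F)) (p : TotalSpace F E) : ℝ :=
  (finBasis ℝ F).repr (trivializationAt F E x₀ p).2 i

theorem eq_sum_stdFrame {x₀ x : B} (hx : x ∈ (trivializationAt F E x₀).baseSet) (v : E x) :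
    v = ∑ i, stdCoord x₀ i (TotalSpace.mk' F x v) • stdFrame F E x₀ i x := by
  set e := trivializationAt F E x₀
  have h := ((e.basisAt (finBasis ℝ F) hx).sum_repr v).symm
  rw [h]
  refine Finset.sum_congr rfl fun i _ => ?_
  rw [← h, stdFrame, e.localFrame_apply_of_mem_baseSet _ hx]
  rfl

theorem continuousAt_stdCoord {Z : Type*} [TopologicalSpace Z] {f : Z → TotalSpace F E} {z₀ : Z}
    (hf : ContinuousAt f z₀) (i) : ContinuousAt (fun z => stdCoord (f z₀).1 i (f z)) z₀ := by
  have h := ((FiberBundle.continuousAt_totalSpace F f).1 hf).2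
  exact ((continuous_apply i).comp
    (finBasis ℝ F).equivFunL.continuous).continuousAt.comp h

variable {EB : Type*} [NormedAddCommGroup EB] [NormedSpace ℝ EB] {HB : Type*} [TopologicalSpace HB]
  {I : ModelWithCorners ℝ EB HB} [ChartedSpace HB B]
  {D : Type*} [NormedAddCommGroup D] [NormedSpace ℝ D]

theorem contDiffAt_stdCoord {f : D → TotalSpace F E} {t₀ : D}
    (hf : ContMDiffAt 𝓘(ℝ, D) (I.prod 𝓘(ℝ, F)) ∞ f t₀) (i) :
    ContDiffAt ℝ ∞ (fun t => stdCoord (f t₀).1 i (f t)) t₀ := by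
  have h := (contMDiffAt_totalSpace.1 hf).2
  rw [contMDiffAt_iff_contDiffAt] at h
  have h2 : ContDiff ℝ ∞ fun v : F => (finBasis ℝ F).repr v i :=
    ((ContinuousLinearMap.proj (R := ℝ) (φ := fun _ => ℝ) i).comp
      ((finBasis ℝ F).equivFunL : F →L[ℝ] _)).contDiff
  exact h2.contDiffAt.comp t₀ h

theorem contMDiffOn_stdFrame [ContMDiffVectorBundle ∞ F E I] (x₀ : B) (i) :
    ContMDiffOn I (I.prod 𝓘(ℝ, F)) ∞ (fun x => TotalSpace.mk' F x (stdFrame F E x₀ i x))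
      (trivializationAt F E x₀).baseSet :=
  (trivializationAt F E x₀).contMDiffOn_localFrame_baseSet ∞ (finBasis ℝ F) i

theorem contMDiffAt_comp_section {U : Set B} (hU : IsOpen U) {σ : ∀ x, E x}
    (hσ : ContMDiffOn I (I.prod 𝓘(ℝ, F)) ∞ (fun x => TotalSpace.mk' F x (σ x)) U) {f : D → B}
    {t₀ : D} (hf : ContMDiffAt 𝓘(ℝ, D) I ∞ f t₀) (ht : f t₀ ∈ U) :
    ContMDiffAt 𝓘(ℝ, D) (I.prod 𝓘(ℝ, F)) ∞ (fun t => TotalSpace.mk' F (f t) (σ (f t))) t₀ :=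
  (hσ.contMDiffAt (hU.mem_nhds ht)).comp t₀ hf

theorem continuousAt_comp_section {U : Set B} (hU : IsOpen U) {σ : ∀ x, E x}
    (hσ : ContMDiffOn I (I.prod 𝓘(ℝ, F)) ∞ (fun x => TotalSpace.mk' F x (σ x)) U)
    {Z : Type*} [TopologicalSpace Z] {f : Z → B}
    {z₀ : Z} (hf : ContinuousAt f z₀) (hz : f z₀ ∈ U) :
    ContinuousAt (fun t => TotalSpace.mk' F (f t) (σ (f t))) z₀ :=
  (hσ.contMDiffAt (hU.mem_nhds hz)).continuousAt.comp hf

end Expansion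

section Sums

variable {B : Type*} [TopologicalSpace B] {F : Type*} [NormedAddCommGroup F] [NormedSpace ℂ F]
  {E : B → Type*} [∀ x, NormedAddCommGroup (E x)] [∀ x, InnerProductSpace ℂ (E x)]
  [TopologicalSpace (TotalSpace F E)] [FiberBundle F E] [VectorBundle ℂ F E]

theorem trivialization_sum {x₀ x : B} (hx : x ∈ (trivializationAt F E x₀).baseSet)
    {ι : Type*} (s : Finset ι) (z : ι → ℂ) (ξ : ι → E x) :
    (trivializationAt F E x₀ (TotalSpace.mk' F x (∑ i ∈ s, z i • ξ i))).2 =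
      ∑ i ∈ s, z i • (trivializationAt F E x₀ (TotalSpace.mk' F x (ξ i))).2 := by
  have h := fun v : E x =>
    congrFun ((trivializationAt F E x₀).coe_linearMapAt_of_mem (R := ℂ) hx) v
  simp only [TotalSpace.mk', ← h, map_sum, map_smul]

theorem continuousAt_sum_smul {Z : Type*} [TopologicalSpace Z] {f : Z → B} {z₀ : Z}
    (hf : ContinuousAt f z₀) {ι : Type*} (s : Finset ι) {z : ι → Z → ℂ}
    (hz : ∀ i ∈ s, ContinuousAt (z i) z₀) {ξ : ι → ∀ t, E (f t)}
    (hξ : ∀ i ∈ s, ContinuousAt (fun t => TotalSpace.mk' F (f t) (ξ i t)) z₀) :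
    ContinuousAt (fun t => TotalSpace.mk' F (f t) (∑ i ∈ s, z i t • ξ i t)) z₀ := by
  rw [FiberBundle.continuousAt_totalSpace]
  refine ⟨hf, ?_⟩
  have hev : ∀ᶠ t in nhds z₀, f t ∈ (trivializationAt F E (f z₀)).baseSet :=
    hf.eventually ((trivializationAt F E (f z₀)).open_baseSet.mem_nhds
      (FiberBundle.mem_baseSet_trivializationAt' _))
  refine ContinuousAt.congr (f := fun t => ∑ i ∈ s,
    z i t • (trivializationAt F E (f z₀) (TotalSpace.mk' F (f t) (ξ i t))).2) ?_
    (hev.mono fun t ht => (trivialization_sum ht s (fun i => z i t) fun i => ξ i t).symm)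
  exact tendsto_finsetSum s fun i hi =>
    (hz i hi).smul ((FiberBundle.continuousAt_totalSpace F _).1 (hξ i hi)).2

variable [VectorBundle ℝ F E]
  {EB : Type*} [NormedAddCommGroup EB] [NormedSpace ℝ EB] {HB : Type*} [TopologicalSpace HB]
  {I : ModelWithCorners ℝ EB HB} [ChartedSpace HB B] [ContMDiffVectorBundle ∞ F E I]
  {D : Type*} [NormedAddCommGroup D] [NormedSpace ℝ D]

/-- Near `t₀` a single trivialization applies and is complex linear on fibres, so the claim reduces
to sums of smooth maps into the model fibre. -/
theorem contMDiffAt_sum_smul {f : D → B} {t₀ : D}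
    (hf : ContMDiffAt 𝓘(ℝ, D) I ∞ f t₀) {ι : Type*} (s : Finset ι) {z : ι → D → ℂ}
    (hz : ∀ i ∈ s, ContDiffAt ℝ ∞ (z i) t₀) {ξ : ι → ∀ t, E (f t)}
    (hξ : ∀ i ∈ s, ContMDiffAt 𝓘(ℝ, D) (I.prod 𝓘(ℝ, F)) ∞
      (fun t => TotalSpace.mk' F (f t) (ξ i t)) t₀) :
    ContMDiffAt 𝓘(ℝ, D) (I.prod 𝓘(ℝ, F)) ∞
      (fun t => TotalSpace.mk' F (f t) (∑ i ∈ s, z i t • ξ i t)) t₀ := by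
  rw [contMDiffAt_totalSpace]
  refine ⟨hf, ?_⟩
  have hev : ∀ᶠ t in nhds t₀, f t ∈ (trivializationAt F E (f t₀)).baseSet :=
    hf.continuousAt.eventually ((trivializationAt F E (f t₀)).open_baseSet.mem_nhds
      (FiberBundle.mem_baseSet_trivializationAt' _))
  rw [contMDiffAt_iff_contDiffAt]
  refine ContDiffAt.congr_of_eventuallyEq (f := fun t => ∑ i ∈ s,
    z i t • (trivializationAt F E (f t₀) (TotalSpace.mk' F (f t) (ξ i t))).2) ?_
    (hev.mono fun t ht => trivialization_sum ht s (fun i => z i t) fun i => ξ i t)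
  exact ContDiffAt.sum fun i hi =>
    (hz i hi).smul (contMDiffAt_iff_contDiffAt.1 (contMDiffAt_totalSpace.1 (hξ i hi)).2)

end Sums

/-! ### Smooth local spanning fields of the horizontal and vertical distributions -/

namespace NAnholonomic

variable {n m : ℕ} {V : Type u} [TopologicalSpace V]
  [ChartedSpace (EuclideanSpace ℝ (Fin (n + m))) V] [IsManifold (𝓡 (n + m)) ∞ V]
  (M : NAnholonomic n m V)

/-- The projections of `TV` onto the summands of `TV = hV ⊕ vV`. -/
def distProj : ∀ (c : Part) (x : V), TangentSpace (𝓡 (n + m)) x →ₗ[ℝ] M.dist c x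
  | .h, x => (LinearMap.id - M.N x).codRestrict _ fun X => by
      change M.N x (X - M.N x X) = 0
      rw [map_sub, M.N_eq x _ (M.N_mem x X), sub_self]
  | .v, x => (M.N x).codRestrict _ fun X => M.N_mem x X

theorem distProj_self (c : Part) (x : V) (X : M.dist c x) : M.distProj c x X = X := by
  cases c
  · ext1
    change (X : TangentSpace (𝓡 (n + m)) x) - M.N x X = X
    rw [show M.N x X = 0 from X.2, sub_zero]
  · ext1
    exact M.N_eq x X X.2

theorem smoothField_distProj (c : Part) {X : ∀ x : V, TangentSpace (𝓡 (n + m)) x} {U : Set V}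
    (hX : SmoothField X U) :
    SmoothField (fun x => (M.distProj c x (X x) : TangentSpace (𝓡 (n + m)) x)) U := by
  have hN : SmoothField (fun x => M.N x (X x)) U := M.N_smooth.comp_contMDiffOn hX
  cases c
  · exact ContMDiffOn.sub_section hX hN
  · exact hN

/-- The projection of a local coordinate vector field to `hV` or `vV`. -/
def distField (c : Part) (x₀ : V)
    (i : Fin (finrank ℝ (EuclideanSpace ℝ (Fin (n + m))))) (x : V) : M.dist c x :=
  M.distProj c x (stdFrame (EuclideanSpace ℝ (Fin (n + m))) (TangentSpace (𝓡 (n + m))) x₀ i x)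

theorem smoothField_distField (c : Part) (x₀ : V) (i) :
    SmoothField (fun x => (M.distField c x₀ i x : TangentSpace (𝓡 (n + m)) x))
      (trivializationAt (EuclideanSpace ℝ (Fin (n + m))) (TangentSpace (𝓡 (n + m))) x₀).baseSet :=
  M.smoothField_distProj c (contMDiffOn_stdFrame x₀ i)

/-- The projected coordinate fields need not be linearly independent. An expansion with smooth
coefficients is enough, and the coordinates in `TV` provide one. -/
theorem eq_sum_distField (c : Part) {x₀ x : V} (hx : x ∈ (trivializationAt
      (EuclideanSpace ℝ (Fin (n + m))) (TangentSpace (𝓡 (n + m))) x₀).baseSet) (X : M.dist c x) :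
    X = ∑ i, stdCoord x₀ i (⟨x, X⟩ : TangentBundle (𝓡 (n + m)) V) • M.distField c x₀ i x := by
  conv_lhs => rw [← M.distProj_self c x X, eq_sum_stdFrame hx (X : TangentSpace (𝓡 (n + m)) x)]
  simp only [map_sum, map_smul]
  rfl

end NAnholonomic

/-! ### Clifford multiplication, grading and metric along maps into the base -/

namespace CliffordDModule

open NAnholonomic

variable {n m : ℕ} {V : Type u} [TopologicalSpace V]
  [ChartedSpace (EuclideanSpace ℝ (Fin (n + m))) V] [IsManifold (𝓡 (n + m)) ∞ V]
  {M : NAnholonomic n m V}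
  {F : Part → Type w'} [∀ c, NormedAddCommGroup (F c)] [∀ c, NormedSpace ℂ (F c)]
  [∀ c, FiniteDimensional ℂ (F c)]
  {E : Part → V → Type w} [∀ c x, NormedAddCommGroup (E c x)]
  [∀ c x, InnerProductSpace ℂ (E c x)] [∀ c, TopologicalSpace (TotalSpace (F c) (E c))]
  [∀ c, FiberBundle (F c) (E c)] [∀ c, VectorBundle ℂ (F c) (E c)]
  [∀ c, VectorBundle ℝ (F c) (E c)]
  [∀ c, ContMDiffVectorBundle ∞ (F c) (E c) (𝓡 (n + m))]
  (𝓔 : CliffordDModule M F E)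
  {D : Type*} [NormedAddCommGroup D] [NormedSpace ℝ D]

/-- Smoothness of `cliff` is given for fields and sections over open subsets of `V`, but is needed
for vectors along maps into `V`, such as the legs of a varying frame. Bilinearity puts the variation
into scalar coordinates, leaving fixed smooth sections of `E`. -/
theorem cliff_expand (c : Part) {x₀ x : V}
    (hx : x ∈ (trivializationAt (F c) (E c) x₀).baseSet)
    (hx' : x ∈ (trivializationAt (EuclideanSpace ℝ (Fin (n + m)))
      (TangentSpace (𝓡 (n + m))) x₀).baseSet) (X : M.dist c x) (ξ : E c x) :
    𝓔.cliff c x X ξ = ∑ p : Fin (finrank ℝ (EuclideanSpace ℝ (Fin (n + m)))) ×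
        Fin (finrank ℝ (F c)),
      ((stdCoord x₀ p.1 (⟨x, X⟩ : TangentBundle (𝓡 (n + m)) V) *
        stdCoord x₀ p.2 (TotalSpace.mk' (F c) x ξ) : ℝ) : ℂ) •
      𝓔.cliff c x (M.distField c x₀ p.1 x) (stdFrame (F c) (E c) x₀ p.2 x) := by
  have h1 : 𝓔.cliff c x X = ∑ i, stdCoord x₀ i (⟨x, X⟩ : TangentBundle (𝓡 (n + m)) V) •
      𝓔.cliff c x (M.distField c x₀ i x) := by
    conv_lhs => rw [M.eq_sum_distField c hx' X]
    simp only [map_sum, map_smul]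
  have h2 : ∀ L : Module.End ℂ (E c x), L ξ = ∑ j, ((stdCoord x₀ j (TotalSpace.mk' (F c) x ξ) : ℝ)
      : ℂ) • L (stdFrame (F c) (E c) x₀ j x) := by
    intro L
    conv_lhs => rw [eq_sum_stdFrame hx ξ]
    simp only [map_sum, ← map_smul, Complex.coe_smul]
  rw [h1, LinearMap.sum_apply, Fintype.sum_prod_type]
  refine Finset.sum_congr rfl fun i _ => ?_
  rw [LinearMap.smul_apply, h2, Finset.smul_sum]
  refine Finset.sum_congr rfl fun j _ => ?_
  rw [Complex.ofReal_mul, mul_smul, Complex.coe_smul, Complex.coe_smul]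

theorem cliff_stdFrame_smooth (c : Part) (x₀ : V) (i j) :
    ContMDiffOn (𝓡 (n + m)) ((𝓡 (n + m)).prod 𝓘(ℝ, F c)) ∞ (fun x => TotalSpace.mk' (F c) x
      (𝓔.cliff c x (M.distField c x₀ i x) (stdFrame (F c) (E c) x₀ j x)))
      ((trivializationAt (F c) (E c) x₀).baseSet ∩ (trivializationAt
        (EuclideanSpace ℝ (Fin (n + m))) (TangentSpace (𝓡 (n + m))) x₀).baseSet) :=
  𝓔.cliff_smooth c _ _ _ (((trivializationAt (F c) (E c) x₀).open_baseSet).inter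
    (trivializationAt _ _ x₀).open_baseSet)
    ((M.smoothField_distField c x₀ i).mono Set.inter_subset_right)
    ((contMDiffOn_stdFrame x₀ j).mono Set.inter_subset_left)

theorem contMDiffAt_cliff (c : Part) {f : D → V} {t₀ : D}
    {X : ∀ t, M.dist c (f t)} {ξ : ∀ t, E c (f t)}
    (hX : ContMDiffAt 𝓘(ℝ, D) (𝓡 (n + m)).tangent ∞
      (fun t => (⟨f t, X t⟩ : TangentBundle (𝓡 (n + m)) V)) t₀)
    (hξ : ContMDiffAt 𝓘(ℝ, D) ((𝓡 (n + m)).prod 𝓘(ℝ, F c)) ∞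
      (fun t => TotalSpace.mk' (F c) (f t) (ξ t)) t₀) :
    ContMDiffAt 𝓘(ℝ, D) ((𝓡 (n + m)).prod 𝓘(ℝ, F c)) ∞
      (fun t => TotalSpace.mk' (F c) (f t) (𝓔.cliff c (f t) (X t) (ξ t))) t₀ := by
  have hf : ContMDiffAt 𝓘(ℝ, D) (𝓡 (n + m)) ∞ f t₀ := (contMDiffAt_totalSpace.1 hξ).1
  have h1 : f t₀ ∈ (trivializationAt (F c) (E c) (f t₀)).baseSet ∩ (trivializationAt
        (EuclideanSpace ℝ (Fin (n + m))) (TangentSpace (𝓡 (n + m))) (f t₀)).baseSet :=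
    ⟨FiberBundle.mem_baseSet_trivializationAt' _, FiberBundle.mem_baseSet_trivializationAt' _⟩
  have hopen := ((trivializationAt (F c) (E c) (f t₀)).open_baseSet).inter (trivializationAt
        (EuclideanSpace ℝ (Fin (n + m))) (TangentSpace (𝓡 (n + m))) (f t₀)).open_baseSet
  have hev := hf.continuousAt.eventually (hopen.mem_nhds h1)
  refine ContMDiffAt.congr_of_eventuallyEq ?_ (hev.mono fun t ht =>
    congrArg (TotalSpace.mk' (F c) (f t)) (𝓔.cliff_expand c ht.1 ht.2 (X t) (ξ t)))
  refine contMDiffAt_sum_smul hf _ (fun p _ => ?_) fun p _ =>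
    contMDiffAt_comp_section hopen (𝓔.cliff_stdFrame_smooth c (f t₀) p.1 p.2) hf h1
  exact Complex.ofRealCLM.contDiff.contDiffAt.comp t₀
    ((contDiffAt_stdCoord hX p.1).mul (contDiffAt_stdCoord hξ p.2))

/-- The continuous version allows the frame bundle itself as parameter space, where smoothness is
only tested along plots. It serves to make the domains of local frames open. -/
theorem continuousAt_cliff (c : Part) {Z : Type*} [TopologicalSpace Z] {f : Z → V} {t₀ : Z}
    {X : ∀ t, M.dist c (f t)} {ξ : ∀ t, E c (f t)}
    (hX : ContinuousAt (fun t => (⟨f t, X t⟩ : TangentBundle (𝓡 (n + m)) V)) t₀)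
    (hξ : ContinuousAt (fun t => TotalSpace.mk' (F c) (f t) (ξ t)) t₀) :
    ContinuousAt (fun t => TotalSpace.mk' (F c) (f t) (𝓔.cliff c (f t) (X t) (ξ t))) t₀ := by
  have hf : ContinuousAt f t₀ := ((FiberBundle.continuousAt_totalSpace (F c) _).1 hξ).1
  have h1 : f t₀ ∈ (trivializationAt (F c) (E c) (f t₀)).baseSet ∩ (trivializationAt
        (EuclideanSpace ℝ (Fin (n + m))) (TangentSpace (𝓡 (n + m))) (f t₀)).baseSet :=
    ⟨FiberBundle.mem_baseSet_trivializationAt' _, FiberBundle.mem_baseSet_trivializationAt' _⟩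
  have hopen := ((trivializationAt (F c) (E c) (f t₀)).open_baseSet).inter (trivializationAt
        (EuclideanSpace ℝ (Fin (n + m))) (TangentSpace (𝓡 (n + m))) (f t₀)).open_baseSet
  have hev := hf.eventually (hopen.mem_nhds h1)
  refine ContinuousAt.congr_of_eventuallyEq ?_ (hev.mono fun t ht =>
    congrArg (TotalSpace.mk' (F c) (f t)) (𝓔.cliff_expand c ht.1 ht.2 (X t) (ξ t)))
  refine continuousAt_sum_smul hf _ (fun p _ => ?_) fun p _ =>
    continuousAt_comp_section hopen (𝓔.cliff_stdFrame_smooth c (f t₀) p.1 p.2) hf h1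
  exact Complex.continuous_ofReal.continuousAt.comp
    ((continuousAt_stdCoord hX p.1).mul (continuousAt_stdCoord hξ p.2))

theorem grading_expand (c : Part) {x₀ x : V}
    (hx : x ∈ (trivializationAt (F c) (E c) x₀).baseSet) (ξ : E c x) :
    𝓔.grading c x ξ = ∑ i : Fin (finrank ℝ (F c)),
      ((stdCoord x₀ i (TotalSpace.mk' (F c) x ξ) : ℝ) : ℂ) •
      𝓔.grading c x (stdFrame (F c) (E c) x₀ i x) := by
  conv_lhs => rw [eq_sum_stdFrame hx ξ]
  simp only [map_sum, ← map_smul, Complex.coe_smul]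

theorem grading_stdFrame_smooth (c : Part) (x₀ : V) (j) :
    ContMDiffOn (𝓡 (n + m)) ((𝓡 (n + m)).prod 𝓘(ℝ, F c)) ∞ (fun x => TotalSpace.mk' (F c) x
      (𝓔.grading c x (stdFrame (F c) (E c) x₀ j x)))
      (trivializationAt (F c) (E c) x₀).baseSet :=
  𝓔.grading_smooth c _ _ (trivializationAt (F c) (E c) x₀).open_baseSet (contMDiffOn_stdFrame x₀ j)

theorem contMDiffAt_grading (c : Part) {f : D → V} {t₀ : D} {ξ : ∀ t, E c (f t)}
    (hξ : ContMDiffAt 𝓘(ℝ, D) ((𝓡 (n + m)).prod 𝓘(ℝ, F c)) ∞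
      (fun t => TotalSpace.mk' (F c) (f t) (ξ t)) t₀) :
    ContMDiffAt 𝓘(ℝ, D) ((𝓡 (n + m)).prod 𝓘(ℝ, F c)) ∞
      (fun t => TotalSpace.mk' (F c) (f t) (𝓔.grading c (f t) (ξ t))) t₀ := by
  have hf : ContMDiffAt 𝓘(ℝ, D) (𝓡 (n + m)) ∞ f t₀ := (contMDiffAt_totalSpace.1 hξ).1
  have h1 : f t₀ ∈ (trivializationAt (F c) (E c) (f t₀)).baseSet :=
    FiberBundle.mem_baseSet_trivializationAt' _
  have hopen := (trivializationAt (F c) (E c) (f t₀)).open_baseSet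
  have hev := hf.continuousAt.eventually (hopen.mem_nhds h1)
  refine ContMDiffAt.congr_of_eventuallyEq ?_ (hev.mono fun t ht =>
    congrArg (TotalSpace.mk' (F c) (f t)) (𝓔.grading_expand c ht (ξ t)))
  exact contMDiffAt_sum_smul hf _ (fun i _ =>
    Complex.ofRealCLM.contDiff.contDiffAt.comp t₀ (contDiffAt_stdCoord hξ i)) fun i _ =>
    contMDiffAt_comp_section hopen (𝓔.grading_stdFrame_smooth c (f t₀) i) hf h1

theorem continuousAt_grading (c : Part) {Z : Type*} [TopologicalSpace Z] {f : Z → V} {t₀ : Z}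
    {ξ : ∀ t, E c (f t)}
    (hξ : ContinuousAt (fun t => TotalSpace.mk' (F c) (f t) (ξ t)) t₀) :
    ContinuousAt (fun t => TotalSpace.mk' (F c) (f t) (𝓔.grading c (f t) (ξ t))) t₀ := by
  have hf : ContinuousAt f t₀ := ((FiberBundle.continuousAt_totalSpace (F c) _).1 hξ).1
  have h1 : f t₀ ∈ (trivializationAt (F c) (E c) (f t₀)).baseSet :=
    FiberBundle.mem_baseSet_trivializationAt' _
  have hopen := (trivializationAt (F c) (E c) (f t₀)).open_baseSet
  have hev := hf.eventually (hopen.mem_nhds h1)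
  refine ContinuousAt.congr_of_eventuallyEq ?_ (hev.mono fun t ht =>
    congrArg (TotalSpace.mk' (F c) (f t)) (𝓔.grading_expand c ht (ξ t)))
  exact continuousAt_sum_smul hf _ (fun i _ =>
    Complex.continuous_ofReal.continuousAt.comp (continuousAt_stdCoord hξ i)) fun i _ =>
    continuousAt_comp_section hopen (𝓔.grading_stdFrame_smooth c (f t₀) i) hf h1

theorem inner_expand (c : Part) {x₀ x : V}
    (hx : x ∈ (trivializationAt (F c) (E c) x₀).baseSet) (ξ η : E c x) :
    inner ℂ ξ η = ∑ i : Fin (finrank ℝ (F c)), ∑ j : Fin (finrank ℝ (F c)),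
      ((stdCoord x₀ i (TotalSpace.mk' (F c) x ξ) *
        stdCoord x₀ j (TotalSpace.mk' (F c) x η) : ℝ) : ℂ) *
      inner ℂ (stdFrame (F c) (E c) x₀ i x) (stdFrame (F c) (E c) x₀ j x) := by
  conv_lhs => rw [eq_sum_stdFrame hx ξ, eq_sum_stdFrame hx η, sum_inner]
  refine Finset.sum_congr rfl fun i _ => ?_
  rw [inner_sum]
  refine Finset.sum_congr rfl fun j _ => ?_
  rw [← Complex.coe_smul, ← Complex.coe_smul, inner_smul_left, inner_smul_right,
    Complex.conj_ofReal, Complex.ofReal_mul, mul_assoc]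

theorem contDiffAt_inner (𝓔 : CliffordDModule M F E) (c : Part) {f : D → V} {t₀ : D} {ξ η : ∀ t, E c (f t)}
    (hξ : ContMDiffAt 𝓘(ℝ, D) ((𝓡 (n + m)).prod 𝓘(ℝ, F c)) ∞
      (fun t => TotalSpace.mk' (F c) (f t) (ξ t)) t₀)
    (hη : ContMDiffAt 𝓘(ℝ, D) ((𝓡 (n + m)).prod 𝓘(ℝ, F c)) ∞
      (fun t => TotalSpace.mk' (F c) (f t) (η t)) t₀) :
    ContDiffAt ℝ ∞ (fun t => inner ℂ (ξ t) (η t)) t₀ := by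
  have hf : ContMDiffAt 𝓘(ℝ, D) (𝓡 (n + m)) ∞ f t₀ := (contMDiffAt_totalSpace.1 hξ).1
  have h1 : f t₀ ∈ (trivializationAt (F c) (E c) (f t₀)).baseSet :=
    FiberBundle.mem_baseSet_trivializationAt' _
  have hopen := (trivializationAt (F c) (E c) (f t₀)).open_baseSet
  have hev := hf.continuousAt.eventually (hopen.mem_nhds h1)
  refine ContDiffAt.congr_of_eventuallyEq ?_ (hev.mono fun t ht =>
    inner_expand c ht (ξ t) (η t))
  refine ContDiffAt.sum fun i _ => ContDiffAt.sum fun j _ => ContDiffAt.mul ?_ ?_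
  · exact Complex.ofRealCLM.contDiff.contDiffAt.comp t₀
      ((contDiffAt_stdCoord hξ i).mul (contDiffAt_stdCoord hη j))
  · have h2 := 𝓔.inner_smooth c _ _ _ hopen (contMDiffOn_stdFrame (f t₀) i)
      (contMDiffOn_stdFrame (f t₀) j)
    exact contMDiffAt_iff_contDiffAt.1 ((h2.contMDiffAt (hopen.mem_nhds h1)).comp t₀ hf)

end CliffordDModule

/-! ### Multiplicity spaces -/

/-- A linear map on the spin module as the family of its values on the standard basis. -/
def homOf (k : ℕ) (X : Type*) [NormedAddCommGroup X] [InnerProductSpace ℂ X] :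
    PiLp 2 (fun _ : Finset (Fin ((k + 1) / 2)) => X) ≃ₗ[ℂ] (SpinModule k →ₗ[ℂ] X) where
  toFun w :=
    { toFun := fun s => ∑ T, s T • w T
      map_add' := fun s t => by simp [add_smul, Finset.sum_add_distrib]
      map_smul' := fun z s => by simp [mul_smul, Finset.smul_sum] }
  map_add' v w := by ext s; simp [smul_add, Finset.sum_add_distrib]
  map_smul' z w := by
    refine LinearMap.ext fun s => ?_
    simp [Finset.smul_sum, smul_comm z]
  invFun h := WithLp.toLp 2 fun T => h (spinE T)
  left_inv w := by
    ext T
    simp only [LinearMap.coe_mk, AddHom.coe_mk, PiLp.single_apply, ite_smul, one_smul, zero_smul]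
    rw [Finset.sum_eq_single T (fun S _ hS => if_neg hS) (by simp), if_pos rfl]
  right_inv h := LinearMap.ext fun s => (map_eq_sum h s).symm

section

variable {k : ℕ} {X : Type*} [NormedAddCommGroup X] [InnerProductSpace ℂ X]

theorem homOf_apply (w : PiLp 2 (fun _ : Finset (Fin ((k + 1) / 2)) => X)) (s : SpinModule k) :
    homOf k X w s = ∑ T, s T • w T := rfl

theorem homOf_symm_apply (h : SpinModule k →ₗ[ℂ] X) (T) : (homOf k X).symm h T = h (spinE T) := rfl

theorem homOf_spinE (w : PiLp 2 (fun _ : Finset (Fin ((k + 1) / 2)) => X)) (T) :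
    homOf k X w (spinE T) = w T := by
  rw [← homOf_symm_apply, LinearEquiv.symm_apply_apply]

end

theorem spinRot_one {k : ℕ} (a : Fin k → ℝ) : spinRot (1 : Spin k) a = a := by
  apply Function.LeftInverse.injective (vecPart_ι k)
  rw [ι_spinRot]; simp

namespace CliffordSystem

variable {k : ℕ} {X : Type*} [NormedAddCommGroup X] [InnerProductSpace ℂ X]
  (A : CliffordSystem k X)

/-- Clifford multiplication by vectors. -/
def vec (a : Fin k → ℝ) (ξ : X) : X := ∑ p, (a p : ℂ) • A.c p ξ

theorem vec_single (p : Fin k) (ξ : X) : A.vec (Pi.single p 1) ξ = A.c p ξ := by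
  rw [vec, Finset.sum_eq_single p (fun q _ hq => by simp [Pi.single_eq_of_ne hq]) (by simp)]
  simp

theorem hom_gammaVec {h : SpinModule k →ₗ[ℂ] X} (hh : h ∈ A.homs) (a : Fin k → ℝ)
    (s : SpinModule k) : h (gammaVec k a s) = A.vec a (h s) := by
  rw [gammaVec_apply, map_sum, vec]
  refine Finset.sum_congr rfl fun p _ => ?_
  rw [map_smul]
  exact congrArg _ (hh (some p) s)

/-- On the spin module `g a = (g a g⁻¹) g`, so precomposition with `g` turns multiplication by `a`
into multiplication by the rotated vector. For odd `k`, evenness survives because `g` commutes with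
the grading. -/
theorem comp_spinRep_mem {A₁ A₂ : CliffordSystem k X} {g : Spin k}
    (hv : ∀ a ξ, A₂.vec a ξ = A₁.vec (spinRot g a) ξ) (hΓ : A₂.Γ = A₁.Γ)
    {h : SpinModule k →ₗ[ℂ] X} (hh : h ∈ A₁.homs) : h ∘ₗ spinRep k g ∈ A₂.homs := by
  rintro (_ | p) s
  · have h1 := hh none (spinRep k g s)
    rw [LinearMap.comp_apply, LinearMap.comp_apply]
    by_cases ho : Odd k
    · simp only [gen, ho, if_true, hΓ] at h1 ⊢
      rw [← h1]
      exact congrArg h (spinGrading_spinRep_spin g s).symm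
    · simp [gen, ho]
  · rw [LinearMap.comp_apply, LinearMap.comp_apply, gen_some, gen_some, ← A₂.vec_single, hv,
      ← A₁.hom_gammaVec hh, ← spinRep_gammaVec, gammaVec_single]
    rfl

/-- The space of morphisms `S → X` as a space of families of vectors, with its Hermitian metric. -/
def mult : Submodule ℂ (PiLp 2 (fun _ : Finset (Fin ((k + 1) / 2)) => X)) :=
  A.homs.comap (homOf k X).toLinearMap

theorem homOf_mem (w : A.mult) : homOf k X w ∈ A.homs := w.2

/-- The multiplicity space is the space of morphisms. -/
def multEquiv : A.mult ≃ₗ[ℂ] A.homs := (homOf k X).ofSubmodule' A.homs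

theorem mult_inner (v w : A.mult) :
    inner ℂ v w = ∑ T, inner ℂ (v.1 T) (w.1 T) := rfl

/-- An element of the multiplicity space from a morphism. -/
def multMk (h : SpinModule k →ₗ[ℂ] X) (hh : h ∈ A.homs) : A.mult :=
  ⟨(homOf k X).symm h, by
    change homOf k X ((homOf k X).symm h) ∈ A.homs
    rwa [LinearEquiv.apply_symm_apply]⟩

theorem homOf_multMk (h : SpinModule k →ₗ[ℂ] X) (hh : h ∈ A.homs) :
    homOf k X (A.multMk h hh) = h := LinearEquiv.apply_symm_apply _ _

theorem multMk_apply (h : SpinModule k →ₗ[ℂ] X) (hh : h ∈ A.homs) (T) :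
    (A.multMk h hh).1 T = h (spinE T) := rfl

theorem mult_ext {v w : A.mult} (h : ∀ s, homOf k X v s = homOf k X w s) : v = w :=
  Subtype.ext ((homOf k X).injective (LinearMap.ext h))

/-- This fixes the rank of the multiplicity space independently of the frame, so that local frames
have the right length at all points. -/
theorem finrank_mult [FiniteDimensional ℂ X] :
    finrank ℂ X = 2 ^ ((k + 1) / 2) * finrank ℂ A.mult := by
  rw [← A.evalEquiv.finrank_eq, finrank_tensorProduct, ← A.multEquiv.finrank_eq]
  simp

/-- The normalization factor of the evaluation `S ⊗ Hom(S, X) → X`. -/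
def evalScale (k : ℕ) : ℂ := ((Real.sqrt 2 ^ ((k + 1) / 2) : ℝ) : ℂ)

theorem evalScale_ne_zero : evalScale k ≠ 0 := by
  rw [evalScale, Complex.ofReal_ne_zero]; positivity

theorem evalScale_sq : (starRingEnd ℂ) (evalScale k) * evalScale k = 2 ^ ((k + 1) / 2) := by
  rw [evalScale, Complex.conj_ofReal, ← Complex.ofReal_mul, ← mul_pow,
    Real.mul_self_sqrt (by norm_num)]
  simp

/-- The isomorphism `S ⊗ Hom(S, X) → X`, normalized so as to be unitary for unitary `X`. -/
def multEval : (SpinModule k ⊗[ℂ] A.mult) ≃ₗ[ℂ] X :=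
  (TensorProduct.congr (LinearEquiv.refl ℂ _) A.multEquiv ≪≫ₗ A.evalEquiv) ≪≫ₗ
    LinearEquiv.smulOfNeZero ℂ X (evalScale k) evalScale_ne_zero

theorem multEval_tmul (s : SpinModule k) (w : A.mult) :
    A.multEval (s ⊗ₜ w) = evalScale k • homOf k X w s := rfl

theorem inner_multEval (hc : ∀ p ξ η, inner ℂ (A.c p ξ) η = -inner ℂ ξ (A.c p η))
    (hΓ : ∀ ξ η, inner ℂ (A.Γ ξ) η = inner ℂ ξ (A.Γ η)) (s t : SpinModule k) (v w : A.mult) :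
    inner ℂ (A.multEval (s ⊗ₜ v)) (A.multEval (t ⊗ₜ w)) = inner ℂ s t * inner ℂ v w := by
  rw [multEval_tmul, multEval_tmul, inner_smul_left, inner_smul_right, ← mul_assoc, evalScale_sq,
    A.inner_hom hc hΓ (A.homOf_mem v) (A.homOf_mem w), mult_inner]
  simp only [homOf_spinE]

/-- The action of a spin group element that carries one Clifford structure to another. -/
def spinAct {A₁ A₂ : CliffordSystem k X} (g : Spin k)
    (hv : ∀ a ξ, A₂.vec a ξ = A₁.vec (spinRot g a) ξ) (hΓ : A₂.Γ = A₁.Γ) :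
    A₁.mult ≃ₗᵢ[ℂ] A₂.mult where
  toFun w := A₂.multMk (homOf k X w ∘ₗ spinRep k g) (comp_spinRep_mem hv hΓ (A₁.homOf_mem w))
  map_add' v w := A₂.mult_ext fun s => by simp [homOf_multMk]
  map_smul' z w := A₂.mult_ext fun s => by simp [homOf_multMk]
  invFun w := A₁.multMk (homOf k X w ∘ₗ spinRep k ((g⁻¹ : Spin k) : Cl k))
    (comp_spinRep_mem (fun a ξ => by
      rw [hv, ← spinRot_mul, mul_inv_cancel, spinRot_one]) hΓ.symm (A₂.homOf_mem w))
  left_inv w := A₁.mult_ext fun s => by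
    rw [homOf_multMk, homOf_multMk, LinearMap.comp_apply, LinearMap.comp_apply, spinRep_spin_inv]
  right_inv w := A₂.mult_ext fun s => by
    rw [homOf_multMk, homOf_multMk, LinearMap.comp_apply, LinearMap.comp_apply, spinRep_inv_spin]
  norm_map' w := by
    have h : inner ℂ (A₂.multMk (homOf k X w ∘ₗ spinRep k g)
        (comp_spinRep_mem hv hΓ (A₁.homOf_mem w))) (A₂.multMk (homOf k X w ∘ₗ spinRep k g)
        (comp_spinRep_mem hv hΓ (A₁.homOf_mem w))) = inner ℂ w w := by
      rw [mult_inner, mult_inner]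
      simp only [multMk_apply, LinearMap.comp_apply]
      rw [sum_inner_spinRep]
      simp only [homOf_spinE]
    have h2 := congrArg (fun z : ℂ => Real.sqrt (RCLike.re z)) h
    exact (norm_eq_sqrt_re_inner (𝕜 := ℂ) _).trans
      (h2.trans (norm_eq_sqrt_re_inner (𝕜 := ℂ) w).symm)

theorem homOf_spinAct {A₁ A₂ : CliffordSystem k X} (g : Spin k)
    (hv : ∀ a ξ, A₂.vec a ξ = A₁.vec (spinRot g a) ξ) (hΓ : A₂.Γ = A₁.Γ) (w : A₁.mult)
    (s : SpinModule k) :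
    homOf k X (spinAct g hv hΓ w) s = homOf k X w (spinRep k g s) :=
  LinearMap.congr_fun (A₂.homOf_multMk _ (comp_spinRep_mem hv hΓ (A₁.homOf_mem w))) s

/-- Precomposition reverses the order of composition, so `g` acts first. This is the order of the
gerbe multiplication. -/
theorem spinAct_mul {A₁ A₂ A₃ : CliffordSystem k X} (g g' : Spin k)
    (hv : ∀ a ξ, A₂.vec a ξ = A₁.vec (spinRot g a) ξ) (hΓ : A₂.Γ = A₁.Γ)
    (hv' : ∀ a ξ, A₃.vec a ξ = A₂.vec (spinRot g' a) ξ) (hΓ' : A₃.Γ = A₂.Γ)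
    (hv'' : ∀ a ξ, A₃.vec a ξ = A₁.vec (spinRot (g * g') a) ξ) (hΓ'' : A₃.Γ = A₁.Γ)
    (w : A₁.mult) :
    spinAct (g * g') hv'' hΓ'' w = spinAct g' hv' hΓ' (spinAct g hv hΓ w) := by
  refine A₃.mult_ext fun s => ?_
  rw [homOf_spinAct, homOf_spinAct, homOf_spinAct, Submonoid.coe_mul, map_mul,
    Module.End.mul_apply]

theorem spinAct_of_eq_unit {g : Spin k} (hv : ∀ a ξ, A.vec a ξ = A.vec (spinRot g a) ξ)
    (hΓ : A.Γ = A.Γ) (ε : ℤˣ) (hg : (g : Cl k) = algebraMap ℝ _ ((ε : ℤ) : ℝ)) (w : A.mult) :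
    spinAct g hv hΓ w = (((ε : ℤ) : ℂ) ^ (-1 : ℤ)) • w := by
  have h : (((ε : ℤ) : ℂ) ^ (-1 : ℤ)) = (((ε : ℤ) : ℝ) : ℂ) := by
    rcases Int.units_eq_one_or ε with rfl | rfl <;> norm_num
  refine A.mult_ext fun s => ?_
  rw [homOf_spinAct, hg, AlgHom.commutes, Algebra.algebraMap_eq_smul_one, h,
    LinearMap.smul_apply, Module.End.one_apply, ← Complex.coe_smul, map_smul, Submodule.coe_smul,
    map_smul, LinearMap.smul_apply]

/-- The sign from anticommuting with a vector arises once on `S` and once on `X`. For odd `k` a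
morphism already commutes with the gradings, and the operation is trivial. -/
theorem grading_mem {h : SpinModule k →ₗ[ℂ] X} (hh : h ∈ A.homs) :
    A.Γ ∘ₗ h ∘ₗ (spinSystem k).Γ ∈ A.homs := by
  rintro (_ | p) s
  · have h1 := hh none
    by_cases ho : Odd k
    · simp only [gen, ho, if_true] at h1 ⊢
      simp only [LinearMap.comp_apply, h1]
    · simp [gen, ho]
  · have h1 := hh (some p)
    simp only [gen_some] at h1 ⊢
    simp only [LinearMap.comp_apply, Γ_c_apply, map_neg, h1, neg_neg]

/-- The grading of the multiplicity space. -/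
def multGrading : A.mult →ₗ[ℂ] A.mult where
  toFun w := A.multMk (A.Γ ∘ₗ homOf k X w ∘ₗ (spinSystem k).Γ) (A.grading_mem (A.homOf_mem w))
  map_add' v w := A.mult_ext fun s => by simp [homOf_multMk]
  map_smul' z w := A.mult_ext fun s => by simp [homOf_multMk]

theorem homOf_multGrading (w : A.mult) (s : SpinModule k) :
    homOf k X (A.multGrading w) s = A.Γ (homOf k X w (spinGrading k s)) :=
  LinearMap.congr_fun (A.homOf_multMk _ (A.grading_mem (A.homOf_mem w))) s

theorem spinGrading_spinE (T : Finset (Fin ((k + 1) / 2))) :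
    spinGrading k (spinE T) = (-1 : ℂ) ^ T.card • spinE T := by
  ext S
  rw [spinGrading_apply, PiLp.smul_apply, PiLp.single_apply, smul_eq_mul]
  split_ifs with h
  · rw [h]
  · simp

theorem multGrading_apply (w : A.mult) (T) :
    (A.multGrading w).1 T =
      (-1 : ℂ) ^ T.card • A.Γ (w.1 T) := by
  rw [← homOf_spinE, homOf_multGrading, spinGrading_spinE, map_smul, map_smul, homOf_spinE]

theorem multGrading_multGrading (w : A.mult) : A.multGrading (A.multGrading w) = w := by
  refine A.mult_ext fun s => ?_
  rw [homOf_multGrading, homOf_multGrading, A.Γ_Γ]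
  exact congrArg _ ((spinSystem k).Γ_Γ s)

theorem multGrading_symm (hΓ : ∀ ξ η, inner ℂ (A.Γ ξ) η = inner ℂ ξ (A.Γ η)) (v w : A.mult) :
    inner ℂ (A.multGrading v) w = inner ℂ v (A.multGrading w) := by
  rw [mult_inner, mult_inner]
  refine Finset.sum_congr rfl fun T _ => ?_
  rw [multGrading_apply, multGrading_apply, inner_smul_left, inner_smul_right, hΓ]
  simp

theorem multGrading_spinAct {A₁ A₂ : CliffordSystem k X} (g : Spin k)
    (hv : ∀ a ξ, A₂.vec a ξ = A₁.vec (spinRot g a) ξ) (hΓ : A₂.Γ = A₁.Γ) (w : A₁.mult) :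
    A₂.multGrading (spinAct g hv hΓ w) = spinAct g hv hΓ (A₁.multGrading w) := by
  refine A₂.mult_ext fun s => ?_
  rw [homOf_multGrading, homOf_spinAct, homOf_spinAct, homOf_multGrading, hΓ,
    spinGrading_spinRep_spin]

theorem multEval_gammaVec (a : Fin k → ℝ) (s : SpinModule k) (w : A.mult) :
    A.multEval (gammaVec k a s ⊗ₜ w) = A.vec a (A.multEval (s ⊗ₜ w)) := by
  rw [multEval_tmul, multEval_tmul, A.hom_gammaVec (A.homOf_mem w), vec, vec, Finset.smul_sum]
  refine Finset.sum_congr rfl fun p _ => ?_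
  rw [map_smul, smul_comm]

theorem multEval_grading (s : SpinModule k) (w : A.mult) :
    A.multEval (spinGrading k s ⊗ₜ A.multGrading w) = A.Γ (A.multEval (s ⊗ₜ w)) := by
  rw [multEval_tmul, multEval_tmul, homOf_multGrading, map_smul]
  exact congrArg (fun s => _ • A.Γ (homOf k X _ s)) ((spinSystem k).Γ_Γ s)

theorem multEval_spinAct {A₁ A₂ : CliffordSystem k X} (g : Spin k)
    (hv : ∀ a ξ, A₂.vec a ξ = A₁.vec (spinRot g a) ξ) (hΓ : A₂.Γ = A₁.Γ) (s : SpinModule k)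
    (w : A₁.mult) :
    A₂.multEval (spinRep k ((g⁻¹ : Spin k) : Cl k) s ⊗ₜ spinAct g hv hΓ w) =
      A₁.multEval (s ⊗ₜ w) := by
  rw [multEval_tmul, multEval_tmul, homOf_spinAct, spinRep_spin_inv]

end CliffordSystem

theorem _root_.LinearIndependent.span_range_eq_top_of_finrank {W : Type*} [AddCommGroup W]
    [Module ℂ W] [FiniteDimensional ℂ W] {r : ℕ} {v : Fin r → W} (hv : LinearIndependent ℂ v)
    (hr : finrank ℂ W = r) : Submodule.span ℂ (Set.range v) = ⊤ :=
  hv.span_eq_top_of_card_eq_finrank' (by simp [hr])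

/-! ### Fibre isomorphisms and constant extensions in a trivialization -/

section

variable {B : Type*} [TopologicalSpace B] {F : Type*} [NormedAddCommGroup F] [NormedSpace ℂ F]
  {E : B → Type*} [∀ x, NormedAddCommGroup (E x)] [∀ x, InnerProductSpace ℂ (E x)]
  [TopologicalSpace (TotalSpace F E)] [FiberBundle F E] [VectorBundle ℂ F E]

variable (F E) in
/-- The isomorphism of a fibre with the model fibre. -/
def fiberEquiv (x : B) : E x ≃ₗ[ℂ] F :=
  (trivializationAt F E x).linearEquivAt (R := ℂ) x (FiberBundle.mem_baseSet_trivializationAt' x)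

theorem continuousAt_add_smul {Z : Type*} [TopologicalSpace Z] {f : Z → B} {z₀ : Z}
    {ξ η : ∀ t, E (f t)} (a b : ℂ)
    (hξ : ContinuousAt (fun t => TotalSpace.mk' F (f t) (ξ t)) z₀)
    (hη : ContinuousAt (fun t => TotalSpace.mk' F (f t) (η t)) z₀) :
    ContinuousAt (fun t => TotalSpace.mk' F (f t) (a • ξ t + b • η t)) z₀ := by
  have h := continuousAt_sum_smul (F := F) ((FiberBundle.continuousAt_totalSpace F _).1 hξ).1
    (Finset.univ : Finset Bool) (z := fun i _ => if i then a else b)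
    (fun _ _ => continuousAt_const) (ξ := fun i => if i then ξ else η)
    (fun i _ => by cases i; exacts [hη, hξ])
  simpa using h

variable [VectorBundle ℝ F E]
  {EB : Type*} [NormedAddCommGroup EB] [NormedSpace ℝ EB] {HB : Type*} [TopologicalSpace HB]
  {I : ModelWithCorners ℝ EB HB} [ChartedSpace HB B] [ContMDiffVectorBundle ∞ F E I]
  {D : Type*} [NormedAddCommGroup D] [NormedSpace ℝ D]

theorem contMDiffAt_add_smul {f : D → B} {t₀ : D} {ξ η : ∀ t, E (f t)} (a b : ℂ)
    (hξ : ContMDiffAt 𝓘(ℝ, D) (I.prod 𝓘(ℝ, F)) ∞ (fun t => TotalSpace.mk' F (f t) (ξ t)) t₀)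
    (hη : ContMDiffAt 𝓘(ℝ, D) (I.prod 𝓘(ℝ, F)) ∞ (fun t => TotalSpace.mk' F (f t) (η t)) t₀) :
    ContMDiffAt 𝓘(ℝ, D) (I.prod 𝓘(ℝ, F)) ∞
      (fun t => TotalSpace.mk' F (f t) (a • ξ t + b • η t)) t₀ := by
  have h := contMDiffAt_sum_smul (F := F) (contMDiffAt_totalSpace.1 hξ).1
    (Finset.univ : Finset Bool) (z := fun i _ => if i then a else b)
    (fun _ _ => contDiffAt_const) (ξ := fun i => if i then ξ else η)
    (fun i _ => by cases i; exacts [hη, hξ])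
  simpa using h

theorem contMDiffOn_symm_const (x₀ : B) (y : F) :
    ContMDiffOn I (I.prod 𝓘(ℝ, F)) ∞ (fun x => TotalSpace.mk' F x
      ((trivializationAt F E x₀).symmₗ ℂ x y)) (trivializationAt F E x₀).baseSet := by
  rw [(trivializationAt F E x₀).contMDiffOn_section_baseSet_iff]
  refine (contMDiffOn_const (c := y)).congr fun x hx => ?_
  rw [Trivialization.coe_symmₗ, Trivialization.apply_mk_symm _ hx]
  exact hx

end

open NAnholonomic

variable {n m : ℕ} {V : Type u} [TopologicalSpace V]
  [ChartedSpace (EuclideanSpace ℝ (Fin (n + m))) V] [IsManifold (𝓡 (n + m)) ∞ V]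
  {M : NAnholonomic n m V}

theorem NAnholonomic.continuous_proj :
    Continuous (fun b : M.FrameBundle => b.1) :=
  continuous_iff_le_induced.2 inf_le_left

theorem NAnholonomic.continuous_leg (c : Part) (i : Fin (c.rank n m)) :
    Continuous (FrameBundle.leg (M := M) c i) :=
  continuous_iff_le_induced.2 (inf_le_right.trans ((iInf_le _ c).trans (iInf_le _ i)))

variable
  {F : Part → Type w'} [∀ c, NormedAddCommGroup (F c)] [∀ c, NormedSpace ℂ (F c)]
  [∀ c, FiniteDimensional ℂ (F c)]
  {E : Part → V → Type w} [∀ c x, NormedAddCommGroup (E c x)]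
  [∀ c x, InnerProductSpace ℂ (E c x)] [∀ c, TopologicalSpace (TotalSpace (F c) (E c))]
  [∀ c, FiberBundle (F c) (E c)] [∀ c, VectorBundle ℂ (F c) (E c)]
  [∀ c, VectorBundle ℝ (F c) (E c)]
  [∀ c, ContMDiffVectorBundle ∞ (F c) (E c) (𝓡 (n + m))]
  (𝓔 : CliffordDModule M F E)

/-! ### The multiplicity bundle as a graded module of the spin bundle gerbe -/

namespace CliffordDModule

/-- The fibres of a Clifford d-module as graded Clifford modules of `C(ℝⁿ)` and `C(ℝᵐ)`, in a
frame. -/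
def system (c : Part) {x : V} (f : M.Frame x) : CliffordSystem (c.rank n m) (E c x) where
  c p := 𝓔.cliff c x (f.basis c p)
  Γ := 𝓔.grading c x
  anticomm p q := by
    refine LinearMap.ext fun ξ => ?_
    have hsq : ∀ X : M.dist c x, 𝓔.cliff c x X (𝓔.cliff c x X ξ) =
      -((M.g.inner x X X : ℝ) : ℂ) • ξ := fun X => 𝓔.cliff_cliff c x X ξ
    -- Polarization of `X · X = -|X|²`.
    have h := hsq (f.basis c p + f.basis c q)
    simp only [map_add, LinearMap.add_apply, hsq, Submodule.coe_add,
      add_apply] at h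
    rw [M.g.symm x (f.basis c q) (f.basis c p)] at h
    simp only [f.orthonormal] at h
    simp only [LinearMap.add_apply, Module.End.mul_apply, LinearMap.smul_apply,
      Module.End.one_apply]
    have h2 : 𝓔.cliff c x (f.basis c p) (𝓔.cliff c x (f.basis c q) ξ) +
        𝓔.cliff c x (f.basis c q) (𝓔.cliff c x (f.basis c p) ξ) =
        ((-2 : ℂ) * (((if p = q then 1 else 0 : ℝ)) : ℂ)) • ξ := by
      simp only [if_true] at h
      push_cast at h
      rw [← sub_eq_zero] at h ⊢
      rw [← h]
      module
    rw [h2]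
    split_ifs <;> simp
  Γ_sq := LinearMap.ext fun ξ => 𝓔.grading_grading c x ξ
  Γ_c p := LinearMap.ext fun ξ => 𝓔.cliff_odd c x _ ξ

theorem system_vec (c : Part) {x : V} (f : M.Frame x) (a : Fin (c.rank n m) → ℝ) (ξ : E c x) :
    (𝓔.system c f).vec a ξ = 𝓔.cliff c x (f.vec c a) ξ := by
  simp only [CliffordSystem.vec, Frame.vec, map_sum, map_smul, LinearMap.sum_apply,
    LinearMap.smul_apply, Complex.coe_smul]
  rfl

/-- This is the compatibility that `spinAct` asks for: changing the frame by `ψ` rotates the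
Clifford structure of the same fibre. -/
theorem system_vec_psi (c : Part) {x : V} {f₁ f₂ : M.Frame x} (ψ : Psi f₁ f₂)
    (a : Fin (c.rank n m) → ℝ) (ξ : E c x) :
    (𝓔.system c f₂).vec a ξ = (𝓔.system c f₁).vec (spinRot (ψ.1 c) a) ξ := by
  rw [system_vec, system_vec, ψ.2]

theorem finiteDimensional_fiber (F : Part → Type w') [∀ c, NormedAddCommGroup (F c)]
    [∀ c, NormedSpace ℂ (F c)] [∀ c, FiniteDimensional ℂ (F c)]
    {E : Part → V → Type w} [∀ c x, NormedAddCommGroup (E c x)]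
    [∀ c x, InnerProductSpace ℂ (E c x)] [∀ c, TopologicalSpace (TotalSpace (F c) (E c))]
    [∀ c, FiberBundle (F c) (E c)] [∀ c, VectorBundle ℂ (F c) (E c)] (c : Part) (x : V) :
    FiniteDimensional ℂ (E c x) :=
  (fiberEquiv (F c) (E c) x).symm.finiteDimensional

theorem finrank_mult_eq (c : Part) (b b' : M.FrameBundle) :
    finrank ℂ (𝓔.system c b.2).mult = finrank ℂ (𝓔.system c b'.2).mult := by
  have : ∀ x, FiniteDimensional ℂ (E c x) := finiteDimensional_fiber F c
  have h := (𝓔.system c b.2).finrank_mult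
  have h' := (𝓔.system c b'.2).finrank_mult
  rw [(fiberEquiv (F c) (E c) b.1).finrank_eq] at h
  rw [(fiberEquiv (F c) (E c) b'.1).finrank_eq] at h'
  exact Nat.eq_of_mul_eq_mul_left (by positivity) (h.symm.trans h')

theorem continuousAt_gen (c : Part) {b₀ : M.FrameBundle} {ξ : ∀ b : M.FrameBundle, E c b.1}
    (hξ : ContinuousAt (fun b => TotalSpace.mk' (F c) b.1 (ξ b)) b₀) (i) :
    ContinuousAt (fun b : M.FrameBundle => TotalSpace.mk' (F c) b.1
      ((𝓔.system c b.2).gen i (ξ b))) b₀ := by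
  rcases i with _ | p
  · by_cases ho : Odd (c.rank n m)
    · simp only [CliffordSystem.gen, ho, if_true]
      exact 𝓔.continuousAt_grading c hξ
    · simpa only [CliffordSystem.gen, ho, if_false, Module.End.one_apply] using hξ
  · exact 𝓔.continuousAt_cliff c (X := fun b : M.FrameBundle => b.2.basis c p)
      (NAnholonomic.continuous_leg c p).continuousAt hξ

/-- The projection is a finite composition of averages of `1` and a conjugation by a generator, so
continuity passes from the generators to it, one factor at a time. -/
theorem continuousAt_proj (c : Part) {b₀ : M.FrameBundle}
    {h : ∀ b : M.FrameBundle, SpinModule (c.rank n m) →ₗ[ℂ] E c b.1}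
    (hh : ∀ s, ContinuousAt (fun b => TotalSpace.mk' (F c) b.1 (h b s)) b₀) (s) :
    ContinuousAt (fun b : M.FrameBundle => TotalSpace.mk' (F c) b.1
      ((𝓔.system c b.2).proj (h b) s)) b₀ := by
  unfold CliffordSystem.proj
  induction (Finset.univ : Finset (Option (Fin (c.rank n m)))).toList generalizing s with
  | nil => simpa only [averageList_nil] using hh s
  | cons i l ih =>
    simp only [averageList_cons, LinearMap.smul_apply, LinearMap.add_apply,
      CliffordSystem.conj_apply, smul_add, smul_smul]
    exact continuousAt_add_smul _ _ (ih s) (𝓔.continuousAt_gen c (ih _) i)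

variable {d : ℕ}

theorem contMDiffAt_gen (c : Part) {p : EuclideanSpace ℝ (Fin d) → M.FrameBundle}
    {U : Set (EuclideanSpace ℝ (Fin d))} (hU : IsOpen U) (hp : M.SmoothPlot U p)
    {t₀ : EuclideanSpace ℝ (Fin d)} (ht : t₀ ∈ U)
    {ξ : ∀ t : EuclideanSpace ℝ (Fin d), E c (p t).1}
    (hξ : ContMDiffAt (𝓡 d) ((𝓡 (n + m)).prod 𝓘(ℝ, F c)) ∞
      (fun t => TotalSpace.mk' (F c) (p t).1 (ξ t)) t₀) (i) :
    ContMDiffAt (𝓡 d) ((𝓡 (n + m)).prod 𝓘(ℝ, F c)) ∞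
      (fun t => TotalSpace.mk' (F c) (p t).1 ((𝓔.system c (p t).2).gen i (ξ t))) t₀ := by
  rcases i with _ | i
  · by_cases ho : Odd (c.rank n m)
    · simp only [CliffordSystem.gen, ho, if_true]
      exact 𝓔.contMDiffAt_grading c hξ
    · simpa only [CliffordSystem.gen, ho, if_false, Module.End.one_apply] using hξ
  · exact 𝓔.contMDiffAt_cliff c (X := fun t => (p t).2.basis c i)
      ((hp.2 c i).contMDiffAt (hU.mem_nhds ht)) hξ

theorem contMDiffAt_proj (c : Part) {p : EuclideanSpace ℝ (Fin d) → M.FrameBundle}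
    {U : Set (EuclideanSpace ℝ (Fin d))} (hU : IsOpen U) (hp : M.SmoothPlot U p)
    {t₀ : EuclideanSpace ℝ (Fin d)} (ht : t₀ ∈ U)
    {h : ∀ t, SpinModule (c.rank n m) →ₗ[ℂ] E c (p t).1}
    (hh : ∀ s, ContMDiffAt (𝓡 d) ((𝓡 (n + m)).prod 𝓘(ℝ, F c)) ∞
      (fun t => TotalSpace.mk' (F c) (p t).1 (h t s)) t₀) (s) :
    ContMDiffAt (𝓡 d) ((𝓡 (n + m)).prod 𝓘(ℝ, F c)) ∞
      (fun t => TotalSpace.mk' (F c) (p t).1 ((𝓔.system c (p t).2).proj (h t) s)) t₀ := by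
  unfold CliffordSystem.proj
  induction (Finset.univ : Finset (Option (Fin (c.rank n m)))).toList generalizing s with
  | nil => simpa only [averageList_nil] using hh s
  | cons i l ih =>
    simp only [averageList_cons, LinearMap.smul_apply, LinearMap.add_apply,
      CliffordSystem.conj_apply, smul_add, smul_smul]
    exact contMDiffAt_add_smul _ _ (ih s) (𝓔.contMDiffAt_gen c hU hp ht (ih _) i)

/-- A local frame of the multiplicity spaces is smooth if its components are smooth along smooth
maps. -/
def SmoothFrame (c : Part) (e : M.LocalFrame (fun b => (𝓔.system c b.2).mult)) : Prop :=
  ∀ i T (d : ℕ) (U : Set (EuclideanSpace ℝ (Fin d)))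
    (p : EuclideanSpace ℝ (Fin d) → M.FrameBundle), IsOpen U → M.SmoothPlot U p →
    (∀ t ∈ U, p t ∈ e.dom) → ∀ t ∈ U, ContMDiffAt (𝓡 d) ((𝓡 (n + m)).prod 𝓘(ℝ, F c)) ∞
      (fun t => TotalSpace.mk' (F c) (p t).1 ((e.vec i (p t)).1 T)) t

/-- A basis at `b₀` is extended as constant linear maps in a trivialization of `E`, then projected
onto the morphisms at each nearby frame. At `b₀` the projection changes nothing; linear independence
is an open condition; and constancy of the rank makes the independent vectors span. -/
theorem exists_smoothFrame (c : Part) (b₀ : M.FrameBundle) :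
    ∃ e, 𝓔.SmoothFrame c e ∧ b₀ ∈ e.dom := by
  have hfd : ∀ x, FiniteDimensional ℂ (E c x) := finiteDimensional_fiber F c
  set r := finrank ℂ (𝓔.system c b₀.2).mult with hr
  let β : Basis (Fin r) ℂ (𝓔.system c b₀.2).mult := finBasis ℂ _
  set e := trivializationAt (F c) (E c) b₀.1 with he
  have hb₀ : b₀.1 ∈ e.baseSet := FiberBundle.mem_baseSet_trivializationAt' _
  let τ : Fin r → ∀ b : M.FrameBundle, SpinModule (c.rank n m) →ₗ[ℂ] E c b.1 := fun i b =>
    e.symmₗ ℂ b.1 ∘ₗ e.linearMapAt ℂ b₀.1 ∘ₗ homOf _ _ (β i).1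
  let v : Fin r → ∀ b : M.FrameBundle, (𝓔.system c b.2).mult := fun i b =>
    (𝓔.system c b.2).multMk ((𝓔.system c b.2).proj (τ i b)) ((𝓔.system c b.2).proj_mem _)
  -- The multiplicity spaces vary with `b`. Reading their elements in the trivialization places them
  -- in one fixed space, where openness of linear independence applies.
  let φ : ∀ b : M.FrameBundle, (𝓔.system c b.2).mult →ₗ[ℂ]
      (Finset (Fin ((c.rank n m + 1) / 2)) → F c) := fun b =>
    { toFun := fun w T => e.linearMapAt ℂ b.1 (w.1 T)
      map_add' := fun w w' => by ext T; simp
      map_smul' := fun z w => by ext T; simp }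
  have hv₀ : ∀ i, v i b₀ = β i := by
    intro i
    refine CliffordSystem.mult_ext _ fun s => ?_
    rw [CliffordSystem.homOf_multMk]
    have : τ i b₀ = homOf _ _ (β i).1 := by
      refine LinearMap.ext fun s => ?_
      exact Trivialization.symmₗ_linearMapAt e hb₀ _
    rw [this, CliffordSystem.proj_of_mem _ (CliffordSystem.homOf_mem _ _)]
  have hcont : ContinuousOn (fun b : M.FrameBundle => fun i => φ b (v i b))
      {b | b.1 ∈ e.baseSet} := by
    intro b hb
    refine ContinuousAt.continuousWithinAt ?_
    refine continuousAt_pi.2 fun i => continuousAt_pi.2 fun T => ?_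
    have h1 : ContinuousAt (fun b : M.FrameBundle => TotalSpace.mk' (F c) b.1 ((v i b).1 T)) b :=
      𝓔.continuousAt_proj c (h := τ i) (fun s => continuousAt_comp_section e.open_baseSet
        (contMDiffOn_symm_const (I := 𝓡 (n + m)) b₀.1 _)
        NAnholonomic.continuous_proj.continuousAt hb) _
    have h2 : ContinuousAt (fun b : M.FrameBundle => (e (TotalSpace.mk' (F c) b.1 ((v i b).1 T))).2)
        b := (((e.continuousOn.continuousAt
          (e.open_source.mem_nhds (by rw [e.mem_source]; exact hb))).comp h1).snd)
    refine h2.congr ?_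
    filter_upwards [(NAnholonomic.continuous_proj.continuousAt (x := b)).eventually
      (e.open_baseSet.mem_nhds hb)] with b' hb'
    exact (congrFun (e.coe_linearMapAt_of_mem (R := ℂ) hb') _).symm
  let dom : Set M.FrameBundle := {b | b.1 ∈ e.baseSet} ∩
    (fun b : M.FrameBundle => fun i => φ b (v i b)) ⁻¹' {f | LinearIndependent ℂ f}
  have hdom : IsOpen dom := hcont.isOpen_inter_preimage
    (e.open_baseSet.preimage NAnholonomic.continuous_proj) isOpen_setOfPred_linearIndependent
  have hli : ∀ b ∈ dom, LinearIndependent ℂ fun i => v i b := fun b hb =>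
    LinearIndependent.of_comp (φ b) hb.2
  let e' : M.LocalFrame (fun b => (𝓔.system c b.2).mult) :=
    { dom := dom
      isOpen := hdom
      rk := r
      vec := v
      linearIndependent := hli
      span := fun b hb => (hli b hb).span_range_eq_top_of_finrank (𝓔.finrank_mult_eq c b b₀) }
  refine ⟨e', ?_, hb₀, ?_⟩
  · intro i T d U p hU hp hpd t ht
    refine 𝓔.contMDiffAt_proj c hU hp ht (h := fun t => τ i (p t)) (fun s => ?_) _
    exact contMDiffAt_comp_section e.open_baseSet (contMDiffOn_symm_const (I := 𝓡 (n + m)) b₀.1 _)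
      (hp.1.contMDiffAt (hU.mem_nhds ht)) (hpd t ht).1
  · change LinearIndependent ℂ fun i => φ b₀ (v i b₀)
    simp only [hv₀]
    refine β.linearIndependent.map' (φ b₀) (LinearMap.ker_eq_bot'.2 fun w hw => ?_)
    refine Subtype.ext ?_
    ext T
    have h1 := congrFun hw T
    have h2 := Trivialization.symmₗ_linearMapAt (R := ℂ) e hb₀ (w.1 T)
    rw [← h2]
    change e.symmₗ ℂ b₀.1 (φ b₀ w T) = 0
    rw [h1]
    exact map_zero _

/-- The bundles of multiplicity spaces. -/
def multBundle (c : Part) : HermitianBundle.{u, w} M where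
  fiber b := (𝓔.system c b.2).mult
  atlas := {e | 𝓔.SmoothFrame c e}
  cover b := 𝓔.exists_smoothFrame c b
  smooth e he e' he' i j d U p hU hp hpd := fun t ht => by
    refine ContDiffAt.contDiffWithinAt ?_
    simp only [CliffordSystem.mult_inner]
    exact ContDiffAt.sum fun T _ => 𝓔.contDiffAt_inner c
      (he i T d U p hU hp (fun t ht => (hpd t ht).1) t ht)
      (he' j T d U p hU hp (fun t ht => (hpd t ht).2) t ht)

/-- Plots of the gerbe are tested by real functionals on the Clifford algebra, whereas matrix
entries of the spin representation are complex valued. Real and imaginary parts bridge the two. -/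
theorem contDiffAt_of_real_functionals {k : ℕ} {g : EuclideanSpace ℝ (Fin d) → Cl k}
    {t₀ : EuclideanSpace ℝ (Fin d)}
    (hg : ∀ ℓ : Cl k →ₗ[ℝ] ℝ, ContDiffAt ℝ ∞ (fun t => ℓ (g t)) t₀) (L : Cl k →ₗ[ℝ] ℂ) :
    ContDiffAt ℝ ∞ (fun t => L (g t)) t₀ := by
  have h1 := Complex.ofRealCLM.contDiff.contDiffAt.comp t₀ (hg (Complex.reLm ∘ₗ L))
  have h2 := Complex.ofRealCLM.contDiff.contDiffAt.comp t₀ (hg (Complex.imLm ∘ₗ L))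
  refine (h1.add (h2.mul (contDiffAt_const (c := Complex.I)))).congr_of_eventuallyEq
    (Filter.Eventually.of_forall fun t => ?_)
  exact (Complex.re_add_im _).symm

/-- The `Ψ⁻¹`-module of multiplicity spaces. -/
def multModule : PsiModule.{u, w} M (-1) where
  bundle := 𝓔.multBundle
  act c _ _ _ ψ := CliffordSystem.spinAct (ψ.1 c) (𝓔.system_vec_psi c ψ) rfl
  act_comp c x f₁ f₂ f₃ ψ χ ξ := 
    CliffordSystem.spinAct_mul (ψ.1 c) (χ.1 c) (𝓔.system_vec_psi c ψ) rfl
      (𝓔.system_vec_psi c χ) rfl (𝓔.system_vec_psi c (ψ.comp χ)) rfl ξ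
  act_weight c x f ζ ε hζ ξ :=
    (𝓔.system c f).spinAct_of_eq_unit (𝓔.system_vec_psi c ζ) rfl ε hζ ξ
  act_smooth c e he e' he' i j d U p hU hp hpd := fun t ht => by
    refine ContDiffAt.contDiffWithinAt ?_
    -- The `T`-component of `w ∘ g` is `w (g e_T)`, expanded by the matrix entries of `g`, which are
    -- smooth along the plot.
    refine ContDiffAt.congr_of_eventuallyEq (f := fun t => ∑ T,
      inner ℂ ((e'.vec j ⟨(p t).pt, (p t).tgt⟩).1 T) (∑ S,
        (spinRep _ ((p t).lift.1 c : Cl (c.rank n m)) (spinE T) S) •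
          (e.vec i ⟨(p t).pt, (p t).src⟩).1 S)) ?_ (Filter.Eventually.of_forall fun t => rfl)
    have hpt : ContMDiffAt (𝓡 d) (𝓡 (n + m)) ∞ (fun t => (p t).pt) t :=
      hp.1.1.contMDiffAt (hU.mem_nhds ht)
    refine ContDiffAt.sum fun T _ => 𝓔.contDiffAt_inner c
      (he' j T d U _ hU hp.2.1 (fun t ht => (hpd t ht).2) t ht) ?_
    refine contMDiffAt_sum_smul hpt _ (fun S _ => ?_) fun S _ =>
      he i S d U _ hU hp.1 (fun t ht => (hpd t ht).1) t ht
    let L : Cl (c.rank n m) →ₗ[ℝ] ℂ :=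
      { toFun := fun a => spinRep _ a (spinE T) S
        map_add' := fun a b => by simp
        map_smul' := fun z a => by simp }
    exact contDiffAt_of_real_functionals
      (fun ℓ => (hp.2.2 c ℓ).contDiffAt (hU.mem_nhds ht)) L

/-- The grading of the module of multiplicity spaces. -/
def multModuleGrading : 𝓔.multModule.Grading where
  op c _ f := (𝓔.system c f).multGrading
  op_op c _ f ξ := (𝓔.system c f).multGrading_multGrading ξ
  symm c x f ξ η := (𝓔.system c f).multGrading_symm (𝓔.grading_symm c x) ξ η
  act c x f₁ f₂ ψ ξ :=
    CliffordSystem.multGrading_spinAct (ψ.1 c) (𝓔.system_vec_psi c ψ) rfl ξ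
  smooth c e he i j d U p hU hp hpd := fun t ht => by
    refine ContDiffAt.contDiffWithinAt ?_
    -- The summand with coefficient `0` only brings the vector into the two-term form of
    -- `contMDiffAt_add_smul`.
    refine ContDiffAt.congr_of_eventuallyEq (f := fun t => ∑ T,
      inner ℂ ((e.vec i (p t)).1 T) ((-1 : ℂ) ^ T.card •
        𝓔.grading c (p t).1 ((e.vec j (p t)).1 T) + (0 : ℂ) • (e.vec j (p t)).1 T)) ?_
      (Filter.Eventually.of_forall fun t => ?_)
    · exact ContDiffAt.sum fun T _ => 𝓔.contDiffAt_inner c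
        (he i T d U p hU hp hpd t ht) (contMDiffAt_add_smul _ _
          (𝓔.contMDiffAt_grading c (he j T d U p hU hp hpd t ht))
          (he j T d U p hU hp hpd t ht))
    · refine Finset.sum_congr rfl fun T _ => congrArg _ ?_
      rw [zero_smul, add_zero]
      exact CliffordSystem.multGrading_apply _ _ _

end CliffordDModule

end NGerbe

end

/-! ### The decomposition of a Clifford d-module -/

theorem mainTheorem2 {n m : ℕ} (hnm : Even (n + m)) {V : Type u} [TopologicalSpace V]
    [ChartedSpace (EuclideanSpace ℝ (Fin (n + m))) V] [IsManifold (𝓡 (n + m)) ∞ V]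
    (M : NGerbe.NAnholonomic n m V)
    {F : NGerbe.Part → Type w'} [∀ c, NormedAddCommGroup (F c)] [∀ c, NormedSpace ℂ (F c)]
    [∀ c, FiniteDimensional ℂ (F c)]
    {E : NGerbe.Part → V → Type w} [∀ c x, NormedAddCommGroup (E c x)]
    [∀ c x, InnerProductSpace ℂ (E c x)] [∀ c, TopologicalSpace (TotalSpace (F c) (E c))]
    [∀ c, FiberBundle (F c) (E c)] [∀ c, VectorBundle ℂ (F c) (E c)]
    [∀ c, VectorBundle ℝ (F c) (E c)]
    [∀ c, ContMDiffVectorBundle ∞ (F c) (E c) (𝓡 (n + m))]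
    (𝓔 : NGerbe.CliffordDModule M F E) :
    ∃ (vC : NGerbe.NAnholonomic.PsiModule.{u, w} M (-1)) (ε : vC.Grading)
      (Φ : ∀ (c : NGerbe.Part) {x : V} (f : M.Frame x),
        (NGerbe.SpinModule (c.rank n m) ⊗[ℂ] vC.fiber c f) ≃ₗ[ℂ] E c x),
      -- `Φ` is an isomorphism of Clifford modules over `C(ℝⁿ)` and `C(ℝᵐ)`
      (∀ c {x : V} (f : M.Frame x) a s ξ,
        Φ c f (NGerbe.gammaVec _ a s ⊗ₜ ξ) = 𝓔.cliff c x (f.vec c a) (Φ c f (s ⊗ₜ ξ))) ∧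
      -- `Φ` is even
      (∀ c {x : V} (f : M.Frame x) s ξ,
        Φ c f (NGerbe.spinGrading _ s ⊗ₜ ε.op c f ξ) = 𝓔.grading c x (Φ c f (s ⊗ₜ ξ))) ∧
      -- `Φ` is equivariant for `Ψ`, which acts on `S` by the spin representation and trivially on
      -- the fibres of the pull-back of `E`
      (∀ c {x : V} {f₁ f₂ : M.Frame x} (ψ : NGerbe.NAnholonomic.Psi f₁ f₂) s ξ,
        Φ c f₂ (NGerbe.spinRep _ ((ψ.1 c)⁻¹ : NGerbe.Spin _) s ⊗ₜ vC.act c ψ ξ) =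
          Φ c f₁ (s ⊗ₜ ξ)) ∧
      -- `Φ` is smooth
      (∀ c, ∀ e ∈ (vC.bundle c).atlas, ∀ i s, ∀ (d : ℕ) (U : Set (EuclideanSpace ℝ (Fin d)))
        (p : EuclideanSpace ℝ (Fin d) → M.FrameBundle), IsOpen U → M.SmoothPlot U p →
        (∀ t ∈ U, p t ∈ e.dom) →
        ContMDiffOn (𝓡 d) ((𝓡 (n + m)).prod 𝓘(ℝ, F c)) ∞
          (fun t => TotalSpace.mk' (F c) (p t).1 (Φ c (p t).2 (s ⊗ₜ e.vec i (p t)))) U) ∧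
      -- `Φ` is unitary wherever Clifford multiplication by vectors is skew-Hermitian
      (∀ c, (∀ x X ξ η, inner ℂ (𝓔.cliff c x X ξ) η = -inner ℂ ξ (𝓔.cliff c x X η)) →
        ∀ {x : V} (f : M.Frame x) s s' ξ ξ',
          inner ℂ (Φ c f (s ⊗ₜ ξ)) (Φ c f (s' ⊗ₜ ξ')) = inner ℂ s s' * inner ℂ ξ ξ') := by
  refine ⟨𝓔.multModule, 𝓔.multModuleGrading, fun c _ f => (𝓔.system c f).multEval,
    fun c x f a s ξ => ?_, fun c x f s ξ => (𝓔.system c f).multEval_grading s ξ,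
    fun c x f₁ f₂ ψ s ξ =>
      NGerbe.CliffordSystem.multEval_spinAct (ψ.1 c) (𝓔.system_vec_psi c ψ) rfl s ξ,
    fun c e he i s d U p hU hp hpd t ht => ?_, fun c hc x f s s' ξ ξ' =>
      (𝓔.system c f).inner_multEval (fun _ => hc x _) (𝓔.grading_symm c x) s s' ξ ξ'⟩
  · exact ((𝓔.system c f).multEval_gammaVec a s ξ).trans (𝓔.system_vec c f a _)
  · refine ContMDiffAt.contMDiffWithinAt ?_
    -- For fixed `s`, evaluation is a combination with constant coefficients of the components
    -- `e_i(T)` of the frame vector, and these are smooth along plots by the choice of atlas.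
    refine ContMDiffAt.congr_of_eventuallyEq (f := fun t => TotalSpace.mk' (F c) (p t).1
      (∑ T, (NGerbe.CliffordSystem.evalScale (c.rank n m) * s T) • (e.vec i (p t)).1 T))
      ?_ (Filter.Eventually.of_forall fun t => ?_)
    · exact NGerbe.contMDiffAt_sum_smul (hp.1.contMDiffAt (hU.mem_nhds ht)) _
        (fun T _ => contDiffAt_const) fun T _ => he i T d U p hU hp hpd t ht
    · refine congrArg (TotalSpace.mk' (F c) (p t).1) ?_
      refine (NGerbe.CliffordSystem.multEval_tmul _ _ _).trans ?_
      rw [NGerbe.homOf_apply, Finset.smul_sum]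
      simp only [mul_smul]
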